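/- Let $G$ be an infinite connected simple graph with vertex set $V$ and edge set $E(G)$, and let $\|G\|$ be its geometric realization: the vertices together with, for each edge $e$, a copy $\mathring e$ of the open interval $(0,1)$ (the inner points of $e$). A ray is a one-way infinite path. Two rays are edge-equivalent if, for every finite set $F$ of edges, they have tails in the same component of $G-F$; the equivalence classes are the edge-ends of $G$, and they form the set $\Omega'(G)$. An edge-end lives in a set if the set contains the vertices of a tail of one of its rays. A finite cut $C=(A,B)$ is the finite set $C$ of all edges between the two sides of a partition $V=A\cup B$ (the empty cut is allowed); $\mathcal B_{\rm fin}(G)$ is the set of finite cuts. - ETOP is the topology on $\|G\|\cup\Omega'(G)$ generated by the open subsets of the open edges $\mathring e$ and by the sets consisting of a component of $\|G\|\setminus X$ (in the 1-complex $\|G\|$) together with all edge-ends that live in it, where $X$ is a finite set of inner points of edges. - FCTOP is the topology on $\|G\|\cup\Omega'(G)$ in which the open subsets of the open edges $\mathring e$ are open, and whose other basic closed sets are: the closed segments inside open edges $\mathring e$; and, for each finite cut $C$ and each component $D$ of $\|G\|$ minus all inner points of edges of $C$, the set $D$ together with the edge-ends that live in $D$, with or without closed partial edges $[z,x_e]$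 added for the edges $e\in C$ that have an end $z$ in $D$ ($x_e$ being an inner point of $e$). - $\widetilde G$ is obtained from $\|G\|\cup\Omega'(G)$ by identifying any two points that lie in the same ETOP-open sets; equivalently, by identifying any two vertices or edge-ends that no finite cut separates. ITOP and IFCTOP are the quotient topologies on $\widetilde G$ of ETOP and of FCTOP. - For a finite set $M=\{C_1,\dots,C_t\}\subseteq\mathcal B_{\rm fin}(G)$ with $C_i=(A_i,B_i)$, the multigraph $\mathcal G_M$ has as vertices the words $X_1\cdots X_t$ with $X_i\in\{A_i,B_i\}$ and $\bigcap_i X_i\ne\emptyset$, and every edge $uv$ of $G$ is an edge of $\mathcal G_M$ between the words whose intersections contain $u$ and $v$. The space $\|\mathcal G_M\|$ carries the topology coherent with the non-loop edges, each a copy of $[0,1]$, and with the unions of the loops at each vertex, where a union of $\kappa$ loops has the Hawaiian earring topology, i.e. that of the subspace of $(S^1)^\kappa$ of all points with at most one coordinate different from the base point. For $M\subseteq M'$ the bonding map $\|\mathcal G_{M'}\|\to\|\mathcal G_M\|$ forgets the letters for the cuts outside $M$ and is the identity on inner points of edges. - For a finite set $E\subseteq E(G)$, the finite multigraph $\mathcal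 G.E$ has the components of $G-E$ as vertices, and each edge $uv\in E$ as an edge between the components of $u$ and $v$; $\|\mathcal G.E\|$ is the corresponding 1-complex. For $E\subseteq E'$ the bonding map $\|\mathcal G.E'\|\to\|\mathcal G.E\|$ sends a component of $G-E'$ to the component of $G-E$ that contains it, contracts each edge of $E'\setminus E$ to the component of $G-E$ that contains it, and is the identity on inner points of edges in $E$. **Theorem.** The two families $(\|\mathcal G_M\|)_M$ and $(\|\mathcal G.E\|)_E$, indexed by the finite subsets of $\mathcal B_{\rm fin}(G)$ and of $E(G)$ ordered by inclusion, are inverse systems of topological spaces, and all the multigraphs $\mathcal G_M$ and $\mathcal G.E$ have finitely many vertices. The following four spaces are homeomorphic: (i) $(\widetilde G,\mathrm{ITOP})$; (ii) $(\widetilde G,\mathrm{IFCTOP})$; (iii) $\varprojlim_M\|\mathcal G_M\|$; (iv) $\varprojlim_E\|\mathcal G.E\|$. More precisely, the two descriptions of $\widetilde G$ agree and the identity of $\widetilde G$ is a homeomorphism between (i) and (ii). In particular ITOP is Hausdorff, and it is an inverse limit of multigraphs with finitely many vertices. -/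

import Mathlib

open Set Topology

namespace EdgeEnds

noncomputable section

/-! ### Multigraphs and their geometric realizations -/

/-- A multigraph (loops and parallel edges allowed) with vertex set `W` and edge set `E`.
The edge `e` joins `src e` and `tgt e`; the order of the two ends serves only to parametrize
the edge by the unit interval. -/
structure Multigraph (W E : Type*) where
  src : E → W
  tgt : E → W

/-- The point set of the geometric realization of a multigraph: its vertices, and for every edge
a copy of the open unit interval (the inner points of the edge). -/
inductive Realization (W E : Type*) where
  | vertex (w : W) : Realization W E
  | inner (e : E) (t : Ioo (0 : ℝ) 1) : Realization W E

namespace Multigraph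

variable {W E : Type*} (H : Multigraph W E)

open Classical in
/-- The characteristic map `[0,1] → ‖H‖` of the closed edge `e`. -/
def edgePoint (e : E) (t : unitInterval) : Realization W E :=
  if h : (t : ℝ) ∈ Ioo (0 : ℝ) 1 then .inner e ⟨t, h⟩
  else if (t : ℝ) = 0 then .vertex (H.src e) else .vertex (H.tgt e)

/-- The topology of `‖H‖` as a one-dimensional complex: a set is open iff its trace on each
closed edge is open. -/
def complexTopology : TopologicalSpace (Realization W E) :=
  ⨆ e : E, TopologicalSpace.coinduced (H.edgePoint e) inferInstance

/-- The vertex `w` together with all inner points of loops at `w`. -/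
def loopsAt (w : W) : Set (Realization W E) :=
  {p | p = .vertex w ∨ ∃ e t, H.src e = w ∧ H.tgt e = w ∧ p = .inner e t}

open Classical in
/-- The coordinates of a point of `loopsAt w` in the product of circles `ℝ/ℤ` indexed by the
loops at `w`: the vertex has all coordinates `0`, and the point with parameter `t` of a loop `e`
has `e`-th coordinate `t mod 1` and all other coordinates `0`. -/
def loopCoord (w : W) :
    Realization W E → ({e : E // H.src e = w ∧ H.tgt e = w} → UnitAddCircle)
  | .vertex _ => fun _ => 0
  | .inner e t => fun e' => if e'.1 = e then ((t : ℝ) : UnitAddCircle) else 0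

/-- The (generalized) Hawaiian earring topology on the union of the loops at `w`: the subspace
topology from the product of circles. -/
def earringTopology (w : W) : TopologicalSpace (H.loopsAt w) :=
  TopologicalSpace.induced (fun p => H.loopCoord w p.1) inferInstance

/-- The topology on `‖H‖` coherent with the Hawaiian earrings formed by the loops at each vertex
and with the closed edges `[0,1]` that are not loops. -/
def earringComplexTopology : TopologicalSpace (Realization W E) :=
  (⨆ w : W, TopologicalSpace.coinduced (Subtype.val : H.loopsAt w → Realization W E)
      (H.earringTopology w)) ⊔
    (⨆ e : {e : E // H.src e ≠ H.tgt e},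
      TopologicalSpace.coinduced (H.edgePoint e.1) inferInstance)

end Multigraph

/-! ### Inverse systems and inverse limits of topological spaces -/

/-- The maps `f i j : X j → X i` (`i ≤ j`) form an inverse system of topological spaces. -/
structure IsInverseSystem {ι : Type*} [Preorder ι] {X : ι → Type*}
    [∀ i, TopologicalSpace (X i)] (f : ∀ i j : ι, i ≤ j → X j → X i) : Prop where
  continuous : ∀ i j (h : i ≤ j), Continuous (f i j h)
  map_self : ∀ i (x : X i), f i i le_rfl x = x
  map_map : ∀ i j k (hij : i ≤ j) (hjk : j ≤ k) (x : X k),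
    f i j hij (f j k hjk x) = f i k (hij.trans hjk) x

/-- The inverse limit: the threads of the system; its coercion to a type carries the subspace
topology from the product. -/
def inverseLimit {ι : Type*} [Preorder ι] {X : ι → Type*}
    (f : ∀ i j : ι, i ≤ j → X j → X i) : Set (∀ i, X i) :=
  {x | ∀ i j (h : i ≤ j), f i j h (x j) = x i}

section Graph

variable {V : Type*} (G : SimpleGraph V)

/-! ### Rays and edge-ends -/

/-- A ray: a one-way infinite path. -/
structure Ray where
  toFun : ℕ → V
  injective : Function.Injective toFun
  adj : ∀ n, G.Adj (toFun n) (toFun (n + 1))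

variable {G} in
/-- Some tail of the ray has all its vertices in `S`. -/
def Ray.HasTailIn (R : Ray G) (S : Set V) : Prop :=
  ∃ n, ∀ k, n ≤ k → R.toFun k ∈ S

/-- Two rays are edge-equivalent if for every finite set `F` of edges they have tails in the same
component of `G - F`. -/
def EdgeEquivalent (R₁ R₂ : Ray G) : Prop :=
  ∀ F : Set (Sym2 V), F.Finite → ∃ K : (G.deleteEdges F).ConnectedComponent,
    R₁.HasTailIn K.supp ∧ R₂.HasTailIn K.supp

variable {G} in
theorem Ray.exists_tail (R : Ray G) {F : Set (Sym2 V)} (hF : F.Finite) :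
    ∃ K : (G.deleteEdges F).ConnectedComponent, R.HasTailIn K.supp := by
  have hinj : Function.Injective fun n => s(R.toFun n, R.toFun (n + 1)) := by
    intro m n h
    rcases Sym2.eq_iff.1 h with ⟨h1, -⟩ | ⟨h1, h2⟩
    · exact R.injective h1
    · have h3 := R.injective h1
      have h4 := R.injective h2
      omega
  have hfin : {n | s(R.toFun n, R.toFun (n + 1)) ∈ F}.Finite := hF.preimage hinj.injOn
  obtain ⟨N, hN⟩ := hfin.bddAbove
  refine ⟨(G.deleteEdges F).connectedComponentMk (R.toFun (N + 1)), N + 1, fun k hk => ?_⟩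
  induction k, hk using Nat.le_induction with
  | base => rfl
  | succ k hk ih =>
    have hadj : (G.deleteEdges F).Adj (R.toFun k) (R.toFun (k + 1)) := by
      rw [SimpleGraph.deleteEdges_adj]
      refine ⟨R.adj k, fun h => ?_⟩
      have := hN h
      omega
    rw [SimpleGraph.ConnectedComponent.mem_supp_iff] at ih ⊢
    rw [← ih]
    exact (SimpleGraph.ConnectedComponent.sound hadj.reachable).symm

/-- Edge-equivalence is an equivalence relation. -/
def edgeEquivalentSetoid : Setoid (Ray G) where
  r := EdgeEquivalent G
  iseqv :=
    { refl := fun R F hF => by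
        obtain ⟨K, hK⟩ := R.exists_tail hF
        exact ⟨K, hK, hK⟩
      symm := fun h F hF => by
        obtain ⟨K, h1, h2⟩ := h F hF
        exact ⟨K, h2, h1⟩
      trans := fun h h' F hF => by
        obtain ⟨K, h1, n, h2⟩ := h F hF
        obtain ⟨K', ⟨m, h3⟩, h4⟩ := h' F hF
        have e1 := h2 (max n m) (le_max_left _ _)
        have e2 := h3 (max n m) (le_max_right _ _)
        rw [SimpleGraph.ConnectedComponent.mem_supp_iff] at e1 e2
        obtain rfl : K = K' := e1.symm.trans e2
        exact ⟨K, h1, h4⟩ }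

/-- The edge-ends of `G`. -/
def EdgeEnd : Type _ := Quotient (edgeEquivalentSetoid G)

variable {G} in
/-- The edge-end `ω` lives in the set `S` of vertices: some ray of `ω` has a tail in `S`. -/
def EdgeEnd.LivesIn (ω : EdgeEnd G) (S : Set V) : Prop :=
  ∃ R : Ray G, (Quotient.mk (edgeEquivalentSetoid G) R : EdgeEnd G) = ω ∧ R.HasTailIn S

/-! ### The space `‖G‖ ∪ Ω'(G)`, with the topologies ETOP and FCTOP -/

/-- `G` as a multigraph; each edge gets an arbitrary (fixed) direction. -/
def toMultigraph : Multigraph V G.edgeSet where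
  src e := (Quot.out e.1).1
  tgt e := (Quot.out e.1).2

/-- The point set `‖G‖ ∪ Ω'(G)`. -/
abbrev EndSpace : Type _ := Realization V G.edgeSet ⊕ EdgeEnd G

/-- The (topological) component of the point `p` in the subset `S` of the 1-complex `‖G‖`. -/
def component (S : Set (Realization V G.edgeSet)) (p : Realization V G.edgeSet) :
    Set (Realization V G.edgeSet) :=
  @connectedComponentIn _ (toMultigraph G).complexTopology S p

variable {G} in
/-- The points of `D ⊆ ‖G‖` together with the edge-ends that live in `D`. -/
def withEnds (D : Set (Realization V G.edgeSet)) : Set (EndSpace G) :=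
  {x | match x with
    | .inl p => p ∈ D
    | .inr ω => ω.LivesIn {v | Realization.vertex v ∈ D}}

variable {G} in
/-- A set of inner points of a single edge, as a set of points of `‖G‖ ∪ Ω'(G)`. -/
def onEdge (e : G.edgeSet) (U : Set (Ioo (0 : ℝ) 1)) : Set (EndSpace G) :=
  {x | ∃ t ∈ U, x = .inl (.inner e t)}

/-- ETOP, generated by the open subsets of the open edges, and by the sets consisting of a
component of `‖G‖ ∖ X` together with the edge-ends that live in it, where `X` is a finite set of
inner points of edges. -/
def etop : TopologicalSpace (EndSpace G) :=
  TopologicalSpace.generateFrom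
    ({O | ∃ (e : G.edgeSet) (U : Set (Ioo (0 : ℝ) 1)), IsOpen U ∧ O = onEdge e U} ∪
     {O | ∃ X : Set (Realization V G.edgeSet), X.Finite ∧ (∀ x ∈ X, ∃ e t, x = .inner e t) ∧
        ∃ p ∉ X, O = withEnds (component G Xᶜ p)})

variable {G} in
/-- The set of edges between `A` and its complement. -/
def cutEdges (A : Set V) : Set (Sym2 V) :=
  {e | ∃ a ∈ A, ∃ b ∉ A, G.Adj a b ∧ e = s(a, b)}

/-- The finite cuts of `G`, including the empty one, as sets of edges. -/
def FinCut : Type _ := {C : Set (Sym2 V) // C.Finite ∧ ∃ A : Set V, cutEdges (G := G) A = C}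

/-- The inner points of the edges in `C`. -/
def innerPoints (C : Set (Sym2 V)) : Set (Realization V G.edgeSet) :=
  {p | ∃ (e : G.edgeSet) (t : Ioo (0 : ℝ) 1), e.1 ∈ C ∧ p = .inner e t}

/-- For every edge `e` of `C` that has an end `z` in `D`, the segment of `e` from `z` up to and
including the inner point of `e` with parameter `c e`. -/
def partialEdges (C : Set (Sym2 V)) (D : Set (Realization V G.edgeSet))
    (c : G.edgeSet → Ioo (0 : ℝ) 1) : Set (Realization V G.edgeSet) :=
  {p | ∃ (e : G.edgeSet) (t : Ioo (0 : ℝ) 1), e.1 ∈ C ∧ p = .inner e t ∧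
    ((.vertex ((toMultigraph G).src e) ∈ D ∧ t ≤ c e) ∨
     (.vertex ((toMultigraph G).tgt e) ∈ D ∧ c e ≤ t))}

/-- FCTOP. The open subsets of the open edges are open. The basic closed sets are the closed
segments in open edges and, for each finite cut `C` and each component `D` of `G` minus the inner
points of the edges of `C`, the set `D` together with the edge-ends that live in `D`, with or
without closed partial edges of `C` attached to `D`. -/
def fctop : TopologicalSpace (EndSpace G) :=
  TopologicalSpace.generateFrom
    ({O | ∃ (e : G.edgeSet) (U : Set (Ioo (0 : ℝ) 1)), IsOpen U ∧ O = onEdge e U} ∪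
     {O | ∃ (e : G.edgeSet) (a b : Ioo (0 : ℝ) 1), Oᶜ = onEdge e (Icc a b)} ∪
     {O | ∃ (C : FinCut G), ∃ p ∉ innerPoints G C.1,
        Oᶜ = withEnds (component G (innerPoints G C.1)ᶜ p)} ∪
     {O | ∃ (C : FinCut G), ∃ p ∉ innerPoints G C.1, ∃ c : G.edgeSet → Ioo (0 : ℝ) 1,
        Oᶜ = withEnds (component G (innerPoints G C.1)ᶜ p ∪
          partialEdges G C.1 (component G (innerPoints G C.1)ᶜ p) c)})

/-! ### The quotients ITOP and IFCTOP -/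

/-- Two points of `‖G‖ ∪ Ω'(G)` are identified for ITOP if they lie in the same ETOP-open sets. -/
def sameNhdsSetoid : Setoid (EndSpace G) where
  r x y := ∀ O : Set (EndSpace G), IsOpen[etop G] O → (x ∈ O ↔ y ∈ O)
  iseqv :=
    { refl := fun _ _ _ => Iff.rfl
      symm := fun h O hO => (h O hO).symm
      trans := fun h h' O hO => (h O hO).trans (h' O hO) }

/-- The quotient of `‖G‖ ∪ Ω'(G)` by the relation of lying in the same ETOP-open sets. -/
def Itop : Type _ := Quotient (sameNhdsSetoid G)

variable {G} in
/-- The class of a point. -/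
def Itop.mk (x : EndSpace G) : Itop G := Quotient.mk (sameNhdsSetoid G) x

/-- ITOP: the quotient topology of ETOP. -/
instance : TopologicalSpace (Itop G) := TopologicalSpace.coinduced Itop.mk (etop G)

variable {G} in
/-- The point is a vertex or an edge-end that lies on the side `A` of the bipartition
`(A, Aᶜ)` of the vertices. -/
def OnSide (A : Set V) : EndSpace G → Prop
  | .inl (.vertex v) => v ∈ A
  | .inl (.inner _ _) => False
  | .inr ω => ω.LivesIn A

variable {G} in
/-- The point is an inner point of an edge. -/
def IsInner : EndSpace G → Prop
  | .inl (.inner _ _) => True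
  | _ => False

/-- Two distinct points are identified for IFCTOP if they are vertices or edge-ends that no finite
cut separates. -/
def cutSetoid : Setoid (EndSpace G) where
  r x y := x = y ∨ (¬ IsInner x ∧ ¬ IsInner y ∧
    ∀ A : Set V, (cutEdges (G := G) A).Finite → (OnSide A x ↔ OnSide A y))
  iseqv :=
    { refl := fun _ => Or.inl rfl
      symm := by
        rintro x y (rfl | ⟨h1, h2, h3⟩)
        · exact Or.inl rfl
        · exact Or.inr ⟨h2, h1, fun A hA => (h3 A hA).symm⟩
      trans := by
        rintro x y z (rfl | ⟨h1, h2, h3⟩) (rfl | ⟨h1', h2', h3'⟩)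
        · exact Or.inl rfl
        · exact Or.inr ⟨h1', h2', h3'⟩
        · exact Or.inr ⟨h1, h2, h3⟩
        · exact Or.inr ⟨h1, h2', fun A hA => (h3 A hA).trans (h3' A hA)⟩ }

/-- The quotient of `‖G‖ ∪ Ω'(G)` by the relation of not being separated by a finite cut. -/
def Ifctop : Type _ := Quotient (cutSetoid G)

variable {G} in
/-- The class of a point. -/
def Ifctop.mk (x : EndSpace G) : Ifctop G := Quotient.mk (cutSetoid G) x

/-- IFCTOP: the quotient topology of FCTOP. -/
instance : TopologicalSpace (Ifctop G) := TopologicalSpace.coinduced Ifctop.mk (fctop G)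

/-! ### The multigraphs `G_M` -/

/-- The vertices of `G_M`: a choice of one side of each cut in `M`, such that the chosen sides have
a common vertex. (In a connected graph exactly two sets `A` satisfy `cutEdges A = C` for a given
cut `C`, the two sides of `C`.) -/
def Word (M : Finset (FinCut G)) : Type _ :=
  {X : M → Set V // (∀ C : M, cutEdges (G := G) (X C) = C.1.1) ∧ (⋂ C, X C).Nonempty}

theorem cutEdges_compl (A : Set V) : cutEdges (G := G) Aᶜ = cutEdges (G := G) A := by
  ext e
  constructor
  · rintro ⟨a, ha, b, hb, hab, rfl⟩
    exact ⟨b, not_not.1 hb, a, ha, hab.symm, Sym2.eq_swap⟩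
  · rintro ⟨a, ha, b, hb, hab, rfl⟩
    exact ⟨b, hb, a, not_not.2 ha, hab.symm, Sym2.eq_swap⟩

open Classical in
variable {G} in
/-- The side of the finite cut `C` that contains the vertex `v`. -/
def FinCut.side (C : FinCut G) (v : V) : Set V :=
  if v ∈ C.2.2.choose then C.2.2.choose else (C.2.2.choose)ᶜ

variable {G} in
theorem FinCut.mem_side (C : FinCut G) (v : V) : v ∈ C.side v := by
  unfold FinCut.side
  split_ifs with h
  · exact h
  · exact h

variable {G} in
theorem FinCut.cutEdges_side (C : FinCut G) (v : V) : cutEdges (G := G) (C.side v) = C.1 := by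
  unfold FinCut.side
  split_ifs with h
  · exact C.2.2.choose_spec
  · rw [cutEdges_compl]; exact C.2.2.choose_spec

/-- The vertex of `G_M` that contains the vertex `v` of `G`. -/
def wordOf (M : Finset (FinCut G)) (v : V) : Word G M :=
  ⟨fun C => C.1.side v, fun C => C.1.cutEdges_side v,
    ⟨v, mem_iInter.2 fun C => C.1.mem_side v⟩⟩

/-- The multigraph `G_M`; it has all the edges of `G`. -/
def cutGraph (M : Finset (FinCut G)) : Multigraph (Word G M) G.edgeSet where
  src e := wordOf G M ((toMultigraph G).src e)
  tgt e := wordOf G M ((toMultigraph G).tgt e)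

/-- The space `‖G_M‖`. -/
def CutGraphSpace (M : Finset (FinCut G)) : Type _ := Realization (Word G M) G.edgeSet

instance (M : Finset (FinCut G)) : TopologicalSpace (CutGraphSpace G M) :=
  (cutGraph G M).earringComplexTopology

/-- The bonding map `‖G_{M'}‖ → ‖G_M‖` for `M ⊆ M'`: it forgets the sides of the cuts outside `M`
and is the identity on inner points of edges. -/
def cutGraphMap (M M' : Finset (FinCut G)) (h : M ≤ M') :
    CutGraphSpace G M' → CutGraphSpace G M
  | .vertex X => .vertex ⟨fun C => X.1 ⟨C.1, h C.2⟩, fun C => X.2.1 ⟨C.1, h C.2⟩, by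
      obtain ⟨v, hv⟩ := X.2.2
      exact ⟨v, mem_iInter.2 fun C => mem_iInter.1 hv ⟨C.1, h C.2⟩⟩⟩
  | .inner e t => .inner e t

/-! ### The finite multigraphs `G.E` -/

/-- The graph `G - E`. -/
def deleteFin (E : Finset G.edgeSet) : SimpleGraph V :=
  G.deleteEdges (Subtype.val '' (E : Set G.edgeSet))

/-- The multigraph `G.E`: its vertices are the components of `G - E`, its edges are those
of `E`. -/
def edgeGraph (E : Finset G.edgeSet) : Multigraph (deleteFin G E).ConnectedComponent E where
  src e := (deleteFin G E).connectedComponentMk ((toMultigraph G).src e.1)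
  tgt e := (deleteFin G E).connectedComponentMk ((toMultigraph G).tgt e.1)

/-- The space `‖G.E‖`. -/
def EdgeGraphSpace (E : Finset G.edgeSet) : Type _ :=
  Realization (deleteFin G E).ConnectedComponent E

/-- The topology of `‖G.E‖` as a 1-complex. -/
instance (E : Finset G.edgeSet) : TopologicalSpace (EdgeGraphSpace G E) :=
  (edgeGraph G E).complexTopology

theorem deleteFin_anti {E E' : Finset G.edgeSet} (h : E ≤ E') :
    deleteFin G E' ≤ deleteFin G E :=
  G.deleteEdges_anti (image_mono (Finset.coe_subset.2 h))

open Classical in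
/-- The bonding map `‖G.E'‖ → ‖G.E‖` for `E ⊆ E'`: a component of `G - E'` is sent to the component
of `G - E` that contains it, an inner point of an edge in `E` to itself, and an edge outside `E` is
contracted to the component of `G - E` that contains it. -/
def edgeGraphMap (E E' : Finset G.edgeSet) (h : E ≤ E') :
    EdgeGraphSpace G E' → EdgeGraphSpace G E
  | .vertex K => .vertex (K.map (SimpleGraph.Hom.ofLE (deleteFin_anti G h)))
  | .inner e t =>
      if he : e.1 ∈ E then .inner ⟨e.1, he⟩ t
      else .vertex ((deleteFin G E).connectedComponentMk ((toMultigraph G).src e.1))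

end Graph

end

end EdgeEnds

namespace EdgeEnds

noncomputable section

/-! All four spaces are compared through one family of real coordinates on `EndSpace G`. A side `A`
of a finite cut gives `sideFun A`, the indicator of `A` on vertices and edge-ends, extended affinely
along the edges. An inner point `s` of an edge `e` gives `bumpFun e s`, a tent on `e` with its peak
at that point. Two points have the same coordinates iff they are equal or are vertices or edge-ends
that no finite cut separates (`cutSetoid_iff_coord_eq`).

ETOP and FCTOP are both induced by these coordinates (`etop_eq_coordTopology`,
`fctop_eq_coordTopology`). For ETOP, a coordinate takes a value strictly between 0 and 1 only at
finitely many points, all inner points of edges, and removing them splits the complex into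
components on which the coordinate stays above or below that value; conversely, each component of
`G` minus finitely many edges is a side of a finite cut. For FCTOP, sublevel sets of coordinates are
finite unions of components of a cut with partial edges attached; finiteness comes from the
connectedness of `G`. Hence the two quotients agree.

Each multigraph is compact and carries part of the same coordinates, which are continuous and
separate its points, so they induce its topology. Bonding maps preserve coordinates, which reduces
the claims about the limits to coordinates (`inverseSystem_of_coordinates`). The remaining content
is that every thread comes from a point. A thread with an inner point somewhere is given by that
inner point. Any other thread chooses compatible sides of all finite cuts, and
`exists_point_of_direction` finds a vertex or edge-end on all of them: if every vertex is excluded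
by some chosen side, then there are nested components of `G` minus finite edge sets that eventually
avoid each vertex, and these contain tails of one ray. -/

/-! ### Tent functions -/

/-- The piecewise linear function with value `0` at `0` and `1` and value `1` at `s`. -/
def tent (s t : ℝ) : ℝ := min (t / s) ((1 - t) / (1 - s))

section Tent

variable {s t c : ℝ}

/-- Clear denominators in both branches of the minimum. The explicit ends of the superlevel interval
are the source of most later estimates on tents. -/
theorem le_tent_iff (hs : s ∈ Ioo (0 : ℝ) 1) :
    c ≤ tent s t ↔ c * s ≤ t ∧ t ≤ 1 - c * (1 - s) := by
  have h1 : 0 < 1 - s := sub_pos.2 hs.2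
  rw [tent, le_min_iff, le_div_iff₀ hs.1, le_div_iff₀ h1]
  exact and_congr Iff.rfl ⟨fun h => by linarith, fun h => by linarith⟩

theorem lt_tent_iff (hs : s ∈ Ioo (0 : ℝ) 1) :
    c < tent s t ↔ c * s < t ∧ t < 1 - c * (1 - s) := by
  have h1 : 0 < 1 - s := sub_pos.2 hs.2
  rw [tent, lt_min_iff, lt_div_iff₀ hs.1, lt_div_iff₀ h1]
  exact and_congr Iff.rfl ⟨fun h => by linarith, fun h => by linarith⟩

theorem continuous_tent (s : ℝ) : Continuous (tent s) := by
  unfold tent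
  fun_prop

theorem tent_zero (hs : s ∈ Ioo (0 : ℝ) 1) : tent s 0 = 0 := by
  have h1 : 0 < 1 - s := sub_pos.2 hs.2
  simp [tent, h1.le]

theorem tent_one (hs : s ∈ Ioo (0 : ℝ) 1) : tent s 1 = 0 := by
  simp [tent, hs.1.le]

theorem tent_self (hs : s ∈ Ioo (0 : ℝ) 1) : tent s s = 1 := by
  simp [tent, hs.1.ne', (sub_pos.2 hs.2).ne']

theorem eq_of_one_le_tent (hs : s ∈ Ioo (0 : ℝ) 1) (h : 1 ≤ tent s t) : t = s := by
  rw [le_tent_iff hs] at h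
  linarith

theorem tent_nonneg (hs : s ∈ Ioo (0 : ℝ) 1) (ht : t ∈ Icc (0 : ℝ) 1) : 0 ≤ tent s t := by
  rw [le_tent_iff hs]
  exact ⟨by linarith [ht.1], by linarith [ht.2]⟩

theorem tent_le_one (hs : s ∈ Ioo (0 : ℝ) 1) : tent s t ≤ 1 := by
  by_contra! h
  rw [lt_tent_iff hs] at h
  linarith

theorem tent_eq (hs : s ∈ Ioo (0 : ℝ) 1) (h : tent s t = c) :
    t = c * s ∨ t = 1 - c * (1 - s) := by
  have h1 := (le_tent_iff hs).1 h.ge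
  have h2 := mt (lt_tent_iff hs).2 h.not_gt
  by_contra! h3
  exact h2 ⟨lt_of_le_of_ne h1.1 h3.1.symm, lt_of_le_of_ne h1.2 h3.2⟩

end Tent

/-! ### Real coordinates on the realization of a multigraph -/

namespace Multigraph

variable {W E : Type*} (H : Multigraph W E)

theorem edgePoint_inner (e : E) (t : unitInterval) (h : (t : ℝ) ∈ Ioo (0 : ℝ) 1) :
    H.edgePoint e t = .inner e ⟨t, h⟩ := dif_pos h

theorem edgePoint_zero (e : E) : H.edgePoint e 0 = .vertex (H.src e) := by
  simp [edgePoint]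

theorem edgePoint_one (e : E) : H.edgePoint e 1 = .vertex (H.tgt e) := by
  simp [edgePoint]

theorem unitInterval_cases (t : unitInterval) : t = 0 ∨ t = 1 ∨ (t : ℝ) ∈ Ioo (0 : ℝ) 1 := by
  rcases eq_or_ne t 0 with h | h
  · exact Or.inl h
  rcases eq_or_ne t 1 with h' | h'
  · exact Or.inr (Or.inl h')
  exact Or.inr (Or.inr ⟨unitInterval.pos_iff_ne_zero.2 h, unitInterval.lt_one_iff_ne_one.2 h'⟩)

/-- The affine extension to all edges of the indicator function of a set of vertices. -/
def height (S : Set W) : Realization W E → ℝ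
  | .vertex w => S.indicator 1 w
  | .inner e t => (1 - t) * S.indicator 1 (H.src e) + t * S.indicator 1 (H.tgt e)

open Classical in
/-- The tent function with peak `s` on the edge `e`, extended by `0`. -/
def _root_.EdgeEnds.bump (e : E) (s : Ioo (0 : ℝ) 1) : Realization W E → ℝ
  | .vertex _ => 0
  | .inner e' t => if e' = e then tent s t else 0

theorem height_edgePoint (S : Set W) (e : E) (t : unitInterval) :
    H.height S (H.edgePoint e t) =
      (1 - t) * S.indicator 1 (H.src e) + t * S.indicator 1 (H.tgt e) := by
  rcases unitInterval_cases t with rfl | rfl | h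
  · simp [edgePoint_zero, height]
  · simp [edgePoint_one, height]
  · rw [edgePoint_inner _ _ _ h]; rfl

open Classical in
theorem bump_edgePoint (e : E) (s : Ioo (0 : ℝ) 1) (e' : E) (t : unitInterval) :
    bump e s (H.edgePoint e' t) = if e' = e then tent s t else 0 := by
  rcases unitInterval_cases t with rfl | rfl | h
  · simp [edgePoint_zero, bump, tent_zero s.2]
  · simp [edgePoint_one, bump, tent_one s.2]
  · rw [edgePoint_inner _ _ _ h]; rfl

theorem height_mem_Icc (S : Set W) (p : Realization W E) : H.height S p ∈ Icc (0 : ℝ) 1 := by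
  classical
  have key : ∀ w : W, S.indicator (1 : W → ℝ) w ∈ Icc (0 : ℝ) 1 := fun w => by
    rw [indicator_apply]; split_ifs <;> simp
  cases p with
  | vertex w => exact key w
  | inner e t =>
    exact convex_Icc (0 : ℝ) 1 (key _) (key _) (sub_nonneg.2 t.2.2.le) t.2.1.le (by ring)

theorem height_compl (S : Set W) (p : Realization W E) :
    H.height Sᶜ p = 1 - H.height S p := by
  have key : ∀ w : W, Sᶜ.indicator (1 : W → ℝ) w = 1 - S.indicator 1 w := fun w => by
    rw [indicator_compl]; rfl
  cases p with
  | vertex w => exact key w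
  | inner e t =>
    simp only [height, key]
    ring

theorem _root_.EdgeEnds.bump_mem_Icc (e : E) (s : Ioo (0 : ℝ) 1) (p : Realization W E) :
    bump e s p ∈ Icc (0 : ℝ) 1 := by
  cases p with
  | vertex w => simp [bump]
  | inner e' t =>
    simp only [bump]
    split_ifs
    · exact ⟨tent_nonneg s.2 ⟨t.2.1.le, t.2.2.le⟩, tent_le_one s.2⟩
    · simp

theorem _root_.EdgeEnds.bump_inner_self (e : E) (s t : Ioo (0 : ℝ) 1) :
    bump (W := W) e s (.inner e t) = tent s t := if_pos rfl

theorem _root_.EdgeEnds.eq_of_bump_eq_one {e : E} {s : Ioo (0 : ℝ) 1} {p : Realization W E}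
    (h : bump e s p = 1) : p = .inner e s := by
  cases p with
  | vertex w => simp [bump] at h
  | inner e' t =>
    simp only [bump] at h
    split_ifs at h with he
    · rw [he, Subtype.ext (eq_of_one_le_tent s.2 h.ge)]
    · simp at h

theorem continuous_height_edgePoint (S : Set W) (e : E) :
    Continuous fun t => H.height S (H.edgePoint e t) := by
  simp only [height_edgePoint]
  fun_prop

theorem continuous_bump_edgePoint (e : E) (s : Ioo (0 : ℝ) 1) (e' : E) :
    Continuous fun t => bump e s (H.edgePoint e' t) := by
  simp only [bump_edgePoint]
  split_ifs
  · exact (continuous_tent s).comp continuous_subtype_val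
  · exact continuous_const

theorem continuous_height (S : Set W) : Continuous[H.complexTopology, _] (H.height S) :=
  continuous_iSup_dom.2 fun e => continuous_coinduced_dom.2 (H.continuous_height_edgePoint S e)

theorem continuous_bump (e : E) (s : Ioo (0 : ℝ) 1) :
    Continuous[H.complexTopology, _] (bump e s : Realization W E → ℝ) :=
  continuous_iSup_dom.2 fun e' =>
    continuous_coinduced_dom.2 (H.continuous_bump_edgePoint e s e')

theorem continuous_edgePoint (e : E) : Continuous[_, H.complexTopology] (H.edgePoint e) :=
  continuous_iff_coinduced_le.2 (le_iSup (fun e => TopologicalSpace.coinduced (H.edgePoint e) _) e)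

theorem vertex_mem_loopsAt (w : W) : .vertex w ∈ H.loopsAt w := Or.inl rfl

/-- The two ends of a loop coincide, so the function is constant on each earring, and only the
non-loops matter. -/
theorem continuous_height_earring (S : Set W) :
    Continuous[H.earringComplexTopology, _] (H.height S) := by
  refine continuous_sup_dom.2 ⟨continuous_iSup_dom.2 fun w => continuous_coinduced_dom.2 ?_,
    continuous_iSup_dom.2 fun e => continuous_coinduced_dom.2 (H.continuous_height_edgePoint S e)⟩
  let := H.earringTopology w
  have : (H.height S ∘ Subtype.val : H.loopsAt w → ℝ) = fun _ => S.indicator 1 w := by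
    funext ⟨p, hp⟩
    rcases hp with rfl | ⟨e, t, rfl, h, rfl⟩
    · rfl
    · simp only [Function.comp, height, h]
      ring
  rw [this]
  exact continuous_const

/-- If `e` is a loop at `w`, the tent factors through the `e`-th circle coordinate, since it has the
same value at both ends of the interval. On the other earrings it vanishes. -/
theorem continuous_bump_earring (e : E) (s : Ioo (0 : ℝ) 1) :
    Continuous[H.earringComplexTopology, _] (bump e s : Realization W E → ℝ) := by
  refine continuous_sup_dom.2 ⟨continuous_iSup_dom.2 fun w => continuous_coinduced_dom.2 ?_,
    continuous_iSup_dom.2 fun e' =>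
      continuous_coinduced_dom.2 (H.continuous_bump_edgePoint e s e')⟩
  let := H.earringTopology w
  by_cases he : H.src e = w ∧ H.tgt e = w
  · have h1 : Continuous (AddCircle.liftIco (1 : ℝ) 0 (tent s)) :=
      AddCircle.liftIco_zero_continuous (by rw [tent_zero s.2, tent_one s.2])
        (continuous_tent s).continuousOn
    have : (bump e s ∘ Subtype.val : H.loopsAt w → ℝ) =
        fun p => AddCircle.liftIco (1 : ℝ) 0 (tent s) (H.loopCoord w p.1 ⟨e, he⟩) := by
      funext ⟨p, hp⟩
      rcases hp with rfl | ⟨e', t, h, h', rfl⟩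
      · have := AddCircle.liftIco_zero_coe_apply (f := tent s) (p := (1 : ℝ)) (x := 0) (by simp)
        rw [AddCircle.coe_zero, tent_zero s.2] at this
        exact this.symm
      · simp only [Function.comp, bump, loopCoord]
        by_cases hee : e' = e
        · subst hee
          rw [if_pos rfl, if_pos rfl]
          exact (AddCircle.liftIco_zero_coe_apply ⟨t.2.1.le, t.2.2⟩).symm
        · rw [if_neg hee, if_neg (Ne.symm hee)]
          have := AddCircle.liftIco_zero_coe_apply (f := tent s) (p := (1 : ℝ)) (x := 0) (by simp)
          rw [AddCircle.coe_zero, tent_zero s.2] at this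
          exact this.symm
    rw [this]
    exact h1.comp ((continuous_apply _).comp continuous_induced_dom)
  · have : (bump e s ∘ Subtype.val : H.loopsAt w → ℝ) = fun _ => 0 := by
      funext ⟨p, hp⟩
      rcases hp with rfl | ⟨e', t, h, h', rfl⟩
      · rfl
      · refine if_neg ?_
        rintro rfl
        exact he ⟨h, h'⟩
    rw [this]
    exact continuous_const

/-! ### Compactness of the realizations. -/

theorem compactSpace_complexTopology [Finite W] [Finite E] :
    @CompactSpace _ H.complexTopology := by
  let := H.complexTopology
  have h : (univ : Set (Realization W E)) =
      range Realization.vertex ∪ ⋃ e, range (H.edgePoint e) := by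
    refine (eq_univ_of_forall fun p => ?_).symm
    cases p with
    | vertex w => exact Or.inl ⟨w, rfl⟩
    | inner e t =>
      exact Or.inr (mem_iUnion.2 ⟨e, ⟨t, t.2.1.le, t.2.2.le⟩, H.edgePoint_inner e _ t.2⟩)
  refine ⟨h ▸ (finite_range _).isCompact.union (isCompact_iUnion fun e => ?_)⟩
  exact isCompact_range (H.continuous_edgePoint e)

/-- Having at most one nonzero coordinate is a closed condition in the product of circles; with
Tychonoff's theorem this makes the earring compact. -/
theorem range_loopCoord (w : W) :
    range (fun p : H.loopsAt w => H.loopCoord w p.1) =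
      {φ | ∀ i j, i ≠ j → φ i = 0 ∨ φ j = 0} := by
  apply Subset.antisymm
  · rintro _ ⟨⟨p, hp⟩, rfl⟩ i j hij
    rcases hp with rfl | ⟨e, t, h, h', rfl⟩
    · exact Or.inl rfl
    · by_cases hi : i.1 = e
      · exact Or.inr (if_neg fun hj => hij (Subtype.ext (hi.trans hj.symm)))
      · exact Or.inl (if_neg hi)
  · intro φ hφ
    by_cases h0 : φ = 0
    · exact ⟨⟨_, H.vertex_mem_loopsAt w⟩, h0.symm⟩
    obtain ⟨e, he⟩ := Function.ne_iff.1 h0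
    obtain ⟨t, ht, hte⟩ : ∃ t ∈ Ico (0 : ℝ) (0 + 1), (t : UnitAddCircle) = φ e := by
      have := (AddCircle.coe_image_Ico_eq (1 : ℝ) 0).ge (mem_univ (φ e))
      exact this
    -- The representative in `[0,1)` of a nonzero point of the circle is an inner parameter of the
    -- loop.
    have ht0 : t ≠ 0 := by
      rintro rfl
      exact he (by rw [← hte]; rfl)
    refine ⟨⟨.inner e.1 ⟨t, lt_of_le_of_ne ht.1 ht0.symm, by simpa using ht.2⟩,
      Or.inr ⟨_, _, e.2.1, e.2.2, rfl⟩⟩, ?_⟩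
    funext i
    simp only [loopCoord]
    split_ifs with hi
    · rw [hte, Subtype.ext hi]
    · exact ((hφ i e fun h => hi (congrArg _ h)).resolve_right he).symm

theorem compactSpace_earring (w : W) : @CompactSpace _ (H.earringTopology w) := by
  let := H.earringTopology w
  have hind : IsInducing (fun p : H.loopsAt w => H.loopCoord w p.1) := ⟨rfl⟩
  refine ⟨hind.isCompact_iff.2 ?_⟩
  rw [image_univ, range_loopCoord]
  refine IsClosed.isCompact ?_
  simp only [ofPred_forall]
  refine isClosed_iInter fun i => isClosed_iInter fun j => isClosed_iInter fun _ => ?_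
  exact (isClosed_singleton.preimage (continuous_apply i)).union
    (isClosed_singleton.preimage (continuous_apply j))

/-- Infinitely many loops do no harm, as they are gathered in finitely many compact earrings. -/
theorem compactSpace_earringComplexTopology [Finite W]
    (hE : {e | H.src e ≠ H.tgt e}.Finite) :
    @CompactSpace _ H.earringComplexTopology := by
  let := H.earringComplexTopology
  have : Finite {e : E // H.src e ≠ H.tgt e} := hE
  have h : (univ : Set (Realization W E)) =
      (⋃ w, range (Subtype.val : H.loopsAt w → _)) ∪
        ⋃ e : {e : E // H.src e ≠ H.tgt e}, range (H.edgePoint e.1) := by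
    refine (eq_univ_of_forall fun p => ?_).symm
    cases p with
    | vertex w => exact Or.inl (mem_iUnion.2 ⟨w, ⟨_, H.vertex_mem_loopsAt w⟩, rfl⟩)
    | inner e t =>
      by_cases he : H.src e = H.tgt e
      · exact Or.inl (mem_iUnion.2 ⟨H.src e, ⟨_, Or.inr ⟨e, t, rfl, he.symm, rfl⟩⟩, rfl⟩)
      · exact Or.inr
          (mem_iUnion.2 ⟨⟨e, he⟩, ⟨t, t.2.1.le, t.2.2.le⟩, H.edgePoint_inner e _ t.2⟩)
  refine ⟨h ▸ (isCompact_iUnion fun w => ?_).union (isCompact_iUnion fun e => ?_)⟩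
  · let := H.earringTopology w
    have := H.compactSpace_earring w
    exact isCompact_range (continuous_iff_coinduced_le.2
      ((le_iSup (fun w => TopologicalSpace.coinduced
        (Subtype.val : H.loopsAt w → Realization W E) (H.earringTopology w)) w).trans le_sup_left))
  · exact isCompact_range (continuous_iff_coinduced_le.2
      ((le_iSup (fun e : {e : E // H.src e ≠ H.tgt e} =>
        TopologicalSpace.coinduced (H.edgePoint e.1) _) e).trans le_sup_right))

end Multigraph

/-! ### Inverse systems of compact spaces with real coordinates -/

/-- A continuous injection from a compact space into a product of lines is a closed embedding. After
this the topologies of the multigraphs enter only through compactness and continuity of the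
coordinates. -/
theorem eq_iInf_induced_of_compactSpace {X J : Type*} [t : TopologicalSpace X] [CompactSpace X]
    (S : Set J) (h : J → X → ℝ) (hcont : ∀ j ∈ S, Continuous (h j))
    (hsep : ∀ x y, (∀ j ∈ S, h j x = h j y) → x = y) :
    t = ⨅ j ∈ S, TopologicalSpace.induced (h j) inferInstance := by
  let F : X → S → ℝ := fun x j => h j x
  have hF : Continuous F := continuous_pi fun j => hcont j j.2
  have hinj : Function.Injective F := fun x y hxy => hsep x y fun j hj => congrFun hxy ⟨j, hj⟩
  have := (hF.isClosedEmbedding hinj).isInducing.eq_induced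
  rw [this, Pi.topologicalSpace, induced_iInf, iInf_subtype']
  simp only [induced_compose]
  rfl

/-- The common frame for both inverse systems. Stage `i` knows the coordinates in `S i`, and these
determine its points and its topology, so every identity and every continuity claim is tested on
coordinates. Only `hex` and `hsurj` relate the system to `Y`: each point of `Y` has an image at each
stage, and each thread comes from a point of `Y`. -/
theorem inverseSystem_of_coordinates {ι J Y : Type*} [Preorder ι] [IsDirected ι (· ≤ ·)]
    {X : ι → Type*} [tX : ∀ i, TopologicalSpace (X i)] [∀ i, CompactSpace (X i)]
    (f : ∀ i j : ι, i ≤ j → X j → X i) (S : ι → Set J) (h : ∀ i, J → X i → ℝ) (k : J → Y → ℝ)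
    (hcont : ∀ i, ∀ j ∈ S i, Continuous (h i j))
    (hsep : ∀ i x y, (∀ j ∈ S i, h i j x = h i j y) → x = y)
    (hmono : Monotone S)
    (hmap : ∀ i i' (hi : i ≤ i') (x : X i'), ∀ j ∈ S i, h i j (f i i' hi x) = h i' j x)
    (hcover : ∀ j, ∃ i, j ∈ S i)
    (hex : ∀ i y, ∃ x, ∀ j ∈ S i, h i j x = k j y)
    (hsurj : ∀ x ∈ inverseLimit f, ∃ y, ∀ i, ∀ j ∈ S i, h i j (x i) = k j y) :
    IsInverseSystem f ∧ T2Space (inverseLimit f) ∧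
      ∃ Φ : Y → inverseLimit f, Function.Surjective Φ ∧
        TopologicalSpace.induced Φ inferInstance =
          ⨅ j, TopologicalSpace.induced (k j) inferInstance ∧
        ∀ y y', Φ y = Φ y' ↔ ∀ j, k j y = k j y' := by
  have htop : ∀ i, tX i =
      ⨅ j ∈ S i, TopologicalSpace.induced (h i j) inferInstance := fun i =>
    eq_iInf_induced_of_compactSpace (S i) (h i) (hcont i) (hsep i)
  have hT2 : ∀ i, T2Space (X i) := fun i => by
    refine T2Space.of_injective_continuous (f := fun x (j : S i) => h i j x)
      (fun x y hxy => hsep i x y fun j hj => congrFun hxy ⟨j, hj⟩)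
      (continuous_pi fun j => hcont i j j.2)
  refine ⟨⟨fun i i' hi => ?_, fun i x => hsep i _ _ fun j hj => hmap i i le_rfl x j hj,
    fun i i' i'' hi hi' x => hsep i _ _ fun j hj => ?_⟩, inferInstance, ?_⟩
  -- A coordinate of `X i` pulled back along the bonding map is the same coordinate of `X i'`, which
  -- is continuous by `hmono`.
  · refine continuous_iff_le_induced.2 ?_
    rw [htop i]
    simp only [induced_iInf, induced_compose]
    refine le_iInf₂ fun j hj => ?_
    rw [show h i j ∘ f i i' hi = h i' j from funext fun x => hmap i i' hi x j hj]
    exact continuous_iff_le_induced.1 (hcont i' j (hmono hi hj))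
  · rw [hmap _ _ _ _ _ hj, hmap _ _ _ _ _ (hmono hi hj), hmap _ _ _ _ _ hj]
  · choose φ hφ using hex
    refine ⟨fun y => ⟨fun i => φ i y, fun i i' hi => hsep i _ _ fun j hj => ?_⟩, ?_, ?_, ?_⟩
    · rw [hmap _ _ _ _ _ hj, hφ _ _ _ hj, hφ _ _ _ (hmono hi hj)]
    · rintro ⟨x, hx⟩
      obtain ⟨y, hy⟩ := hsurj x hx
      exact ⟨y, Subtype.ext (funext fun i => hsep i _ _ fun j hj => by
        rw [hφ _ _ _ hj, hy _ _ hj])⟩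
    · change TopologicalSpace.induced _ (TopologicalSpace.induced Subtype.val
        Pi.topologicalSpace) = _
      rw [induced_compose, Pi.topologicalSpace, induced_iInf]
      have : ∀ i, TopologicalSpace.induced
          (Subtype.val ∘ fun y => (⟨fun i => φ i y, fun i i' hi => hsep i _ _ fun j hj => by
            rw [hmap _ _ _ _ _ hj, hφ _ _ _ hj, hφ _ _ _ (hmono hi hj)]⟩ : inverseLimit f))
          (TopologicalSpace.induced (fun x : ∀ i, X i => x i) inferInstance) =
          ⨅ j ∈ S i, TopologicalSpace.induced (k j) inferInstance := fun i => by
        rw [induced_compose, htop i]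
        simp only [induced_iInf, induced_compose]
        refine iInf_congr fun j => iInf_congr fun hj => ?_
        rw [show k j = h i j ∘ fun y => φ i y from funext fun y => (hφ i y j hj).symm]
        rfl
      -- Every coordinate occurs at some stage, and every stage uses only some of the coordinates.
      refine le_antisymm (le_iInf fun j => ?_) (le_iInf fun i => ?_)
      · obtain ⟨i, hi⟩ := hcover j
        exact ((iInf_le _ i).trans (this i).le).trans (iInf₂_le j hi)
      · exact (le_iInf₂ fun j _ => iInf_le _ j).trans (this i).ge
    · intro y y'
      refine ⟨fun hyy j => ?_, fun hyy => Subtype.ext (funext fun i => hsep i _ _ fun j hj => ?_)⟩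
      · obtain ⟨i, hi⟩ := hcover j
        rw [← hφ i y j hi, ← hφ i y' j hi]
        exact congrArg (h i j) (congrFun (congrArg Subtype.val hyy) i)
      · change h i j (φ i y) = h i j (φ i y')
        rw [hφ _ _ _ hj, hφ _ _ _ hj, hyy]

/-- When the topology is induced by a surjection, all open sets are preimages, so the quotient by
the fibres has exactly the open sets of the target. -/
theorem exists_homeomorph_quotient {X Y : Type*} [TopologicalSpace Y] (t : TopologicalSpace X)
    (s : Setoid X) (Φ : X → Y) (hsurj : Function.Surjective Φ)
    (hind : t = TopologicalSpace.induced Φ inferInstance)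
    (hs : ∀ x y, s.r x y ↔ Φ x = Φ y) :
    ∃ h : @Homeomorph (Quotient s) Y (TopologicalSpace.coinduced (Quotient.mk s) t) _,
      ∀ x, @Homeomorph.toEquiv _ _ (_) _ h (Quotient.mk s x) = Φ x := by
  let : TopologicalSpace (Quotient s) := TopologicalSpace.coinduced (Quotient.mk s) t
  let F : Quotient s → Y := Quotient.lift Φ fun x y h => (hs x y).1 h
  have hF : Function.Bijective F := by
    refine ⟨fun a b => ?_, fun y => ?_⟩
    · induction a using Quotient.inductionOn
      induction b using Quotient.inductionOn
      exact fun h => Quotient.sound ((hs _ _).2 h)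
    · obtain ⟨x, rfl⟩ := hsurj y
      exact ⟨Quotient.mk s x, rfl⟩
  have hc : Continuous F := by
    refine continuous_coinduced_dom.2 ?_
    rw [hind]
    exact continuous_induced_dom
  have ho : IsOpenMap F := by
    intro U hU
    have hU' : IsOpen[t] (Quotient.mk s ⁻¹' U) := hU
    rw [hind] at hU'
    obtain ⟨O, hO, hOU⟩ := hU'
    have : F '' U = O := by
      ext y
      obtain ⟨x, rfl⟩ := hsurj y
      have hx : Quotient.mk s x ∈ U ↔ Φ x ∈ O := by
        rw [← mem_preimage, ← hOU]; rfl
      rw [← hx]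
      refine ⟨?_, fun h => ⟨_, h, rfl⟩⟩
      rintro ⟨q, hq, h⟩
      exact hF.1 (a₂ := Quotient.mk s x) h ▸ hq
    rwa [this]
  exact ⟨(Equiv.ofBijective F hF).toHomeomorphOfContinuousOpen hc ho, fun x => rfl⟩

variable {V : Type*} {G : SimpleGraph V}

/-! ### Finite cuts, components and edge-ends -/

theorem Ray.HasTailIn.mono {R : Ray G} {S T : Set V} (h : R.HasTailIn S) (hST : S ⊆ T) :
    R.HasTailIn T := by
  obtain ⟨n, hn⟩ := h
  exact ⟨n, fun k hk => hST (hn k hk)⟩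

theorem Ray.HasTailIn.inter {R : Ray G} {S T : Set V} (h : R.HasTailIn S) (h' : R.HasTailIn T) :
    R.HasTailIn (S ∩ T) := by
  obtain ⟨n, hn⟩ := h
  obtain ⟨m, hm⟩ := h'
  exact ⟨max n m, fun k hk =>
    ⟨hn k ((le_max_left _ _).trans hk), hm k ((le_max_right _ _).trans hk)⟩⟩

theorem Ray.HasTailIn.nonempty {R : Ray G} {S : Set V} (h : R.HasTailIn S) : S.Nonempty := by
  obtain ⟨n, hn⟩ := h
  exact ⟨_, hn n le_rfl⟩

theorem EdgeEnd.LivesIn.mono {ω : EdgeEnd G} {S T : Set V} (h : ω.LivesIn S) (hST : S ⊆ T) :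
    ω.LivesIn T := by
  obtain ⟨R, hR, h⟩ := h
  exact ⟨R, hR, h.mono hST⟩

theorem EdgeEnd.LivesIn.nonempty {ω : EdgeEnd G} {S : Set V} (h : ω.LivesIn S) : S.Nonempty := by
  obtain ⟨R, -, h⟩ := h
  exact h.nonempty

theorem mem_of_adj_of_cutEdges_subset {F : Set (Sym2 V)} {A : Set V}
    (hA : cutEdges (G := G) A ⊆ F) {u v : V} (huv : (G.deleteEdges F).Adj u v) (hu : u ∈ A) :
    v ∈ A := by
  rw [SimpleGraph.deleteEdges_adj] at huv
  by_contra hv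
  exact huv.2 (hA ⟨u, hu, v, hv, huv.1, rfl⟩)

theorem mem_of_reachable_of_cutEdges_subset {F : Set (Sym2 V)} {A : Set V}
    (hA : cutEdges (G := G) A ⊆ F) {u v : V} (huv : (G.deleteEdges F).Reachable u v)
    (hu : u ∈ A) : v ∈ A := by
  obtain ⟨p⟩ := huv
  induction p with
  | nil => exact hu
  | cons h p ih => exact ih (mem_of_adj_of_cutEdges_subset hA h hu)

/-- A walk in `G - F` cannot cross the boundary of `A`, so `A` is a union of components of `G - F`.
-/
theorem mem_iff_of_mem_supp {F : Set (Sym2 V)} {A : Set V} (hA : cutEdges (G := G) A ⊆ F)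
    {K : (G.deleteEdges F).ConnectedComponent} {u v : V} (hu : u ∈ K.supp) (hv : v ∈ K.supp) :
    u ∈ A ↔ v ∈ A := by
  have h : (G.deleteEdges F).Reachable u v :=
    SimpleGraph.ConnectedComponent.exact (Eq.trans hu (Eq.symm hv))
  exact ⟨mem_of_reachable_of_cutEdges_subset hA h, mem_of_reachable_of_cutEdges_subset hA h.symm⟩

theorem cutEdges_supp_subset {F : Set (Sym2 V)} (K : (G.deleteEdges F).ConnectedComponent) :
    cutEdges (G := G) K.supp ⊆ F := by
  rintro _ ⟨a, ha, b, hb, hab, rfl⟩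
  by_contra h
  refine hb (Eq.trans ?_ ha)
  have : (G.deleteEdges F).Adj b a := by
    rw [SimpleGraph.deleteEdges_adj, Sym2.eq_swap]
    exact ⟨hab.symm, h⟩
  exact SimpleGraph.ConnectedComponent.sound this.reachable

theorem EdgeEnd.exists_livesIn_component (ω : EdgeEnd G) {F : Set (Sym2 V)} (hF : F.Finite) :
    ∃ v, ω.LivesIn ((G.deleteEdges F).connectedComponentMk v).supp := by
  induction ω using Quotient.inductionOn with
  | h R =>
    obtain ⟨K, hK⟩ := R.exists_tail hF
    obtain ⟨v, rfl⟩ := K.exists_rep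
    exact ⟨v, R, rfl, hK⟩

/-- Two rays of one edge-end have tails in a common component of `G` minus the cut, and that
component lies on one side. -/
theorem EdgeEnd.LivesIn.compl {ω : EdgeEnd G} {A : Set V} (hA : (cutEdges (G := G) A).Finite)
    (h : ω.LivesIn A) : ¬ ω.LivesIn Aᶜ := by
  rintro ⟨R', hR', h'⟩
  obtain ⟨R, hR, h⟩ := h
  obtain ⟨K, hK, hK'⟩ := Quotient.exact (hR.trans hR'.symm) _ hA
  obtain ⟨u, hu, huA⟩ := (hK.inter h).nonempty
  obtain ⟨v, hv, hvA⟩ := (hK'.inter h').nonempty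
  exact hvA ((mem_iff_of_mem_supp subset_rfl hu hv).1 huA)

/-- With respect to cuts inside a fixed finite `F`, an edge-end behaves like any vertex of the
component in which it lives. This is how edge-ends are replaced by vertices later. -/
theorem EdgeEnd.livesIn_iff_mem {ω : EdgeEnd G} {F : Set (Sym2 V)} (hF : F.Finite) {v : V}
    (hv : ω.LivesIn ((G.deleteEdges F).connectedComponentMk v).supp) {A : Set V}
    (hA : cutEdges (G := G) A ⊆ F) : ω.LivesIn A ↔ v ∈ A := by
  have key : ∀ B : Set V, cutEdges (G := G) B ⊆ F → v ∈ B → ω.LivesIn B := fun B hB hvB =>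
    hv.mono fun u hu => (mem_iff_of_mem_supp (A := B) (u := v) hB rfl hu).1 hvB
  refine ⟨fun h => by_contra fun hvA => ?_, key A hA⟩
  exact h.compl (hF.subset hA) (key Aᶜ (by rwa [cutEdges_compl]) hvA)

theorem EdgeEnd.livesIn_compl_iff {ω : EdgeEnd G} {A : Set V}
    (hA : (cutEdges (G := G) A).Finite) : ω.LivesIn Aᶜ ↔ ¬ ω.LivesIn A := by
  obtain ⟨v, hv⟩ := ω.exists_livesIn_component hA
  rw [EdgeEnd.livesIn_iff_mem hA hv subset_rfl,
    EdgeEnd.livesIn_iff_mem hA hv (by rw [cutEdges_compl]), mem_compl_iff]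

theorem finite_setOf_mem_edge {F : Set (Sym2 V)} (hF : F.Finite) :
    {w | ∃ e ∈ F, w ∈ e}.Finite := by
  refine (hF.biUnion (t := fun e => {w | w ∈ e}) fun e _ => ?_).subset fun w ⟨e, he, hw⟩ =>
    mem_iUnion₂.2 ⟨e, he, hw⟩
  induction e with
  | h a b => exact ((finite_singleton b).insert a).subset fun w hw => by simpa using hw

/-- Follow a walk from `v` to `v₀` until it first meets an edge of `F`: it has then reached one of
the finitely many ends of edges in `F`, or else it arrives at `v₀`. -/
theorem exists_reachable_of_finite (hG : G.Connected) {F : Set (Sym2 V)} (hF : F.Finite) :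
    ∃ S : Set V, S.Finite ∧ ∀ v, ∃ w ∈ S, (G.deleteEdges F).Reachable v w := by
  obtain ⟨v₀⟩ := hG.nonempty
  refine ⟨insert v₀ {w | ∃ e ∈ F, w ∈ e}, (finite_setOf_mem_edge hF).insert _, fun v => ?_⟩
  obtain ⟨p⟩ := hG.preconnected v v₀
  induction p with
  | nil => exact ⟨_, mem_insert _ _, .rfl⟩
  | @cons u v v₀ h p ih =>
    by_cases hF' : s(u, v) ∈ F
    · exact ⟨u, Or.inr ⟨_, hF', Sym2.mem_mk_left _ _⟩, .rfl⟩
    · obtain ⟨w, hw, hvw⟩ := ih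
      have : (G.deleteEdges F).Adj u v := by
        rw [SimpleGraph.deleteEdges_adj]
        exact ⟨h, hF'⟩
      exact ⟨w, hw, this.reachable.trans hvw⟩

theorem finite_connectedComponent_deleteEdges (hG : G.Connected) {F : Set (Sym2 V)}
    (hF : F.Finite) : Finite (G.deleteEdges F).ConnectedComponent := by
  obtain ⟨S, hS, h⟩ := exists_reachable_of_finite hG hF
  have : Finite S := hS
  refine Finite.of_surjective (fun w : S => (G.deleteEdges F).connectedComponentMk w) fun K => ?_
  obtain ⟨v, rfl⟩ := K.exists_rep
  obtain ⟨w, hw, hvw⟩ := h v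
  exact ⟨⟨w, hw⟩, (SimpleGraph.ConnectedComponent.sound hvw).symm⟩

/-! ### The ends of the edges -/

theorem mk_src_tgt (e : G.edgeSet) :
    s((toMultigraph G).src e, (toMultigraph G).tgt e) = e.1 := Quot.out_eq e.1

theorem adj_src_tgt (e : G.edgeSet) :
    G.Adj ((toMultigraph G).src e) ((toMultigraph G).tgt e) := by
  rw [← SimpleGraph.mem_edgeSet, mk_src_tgt]
  exact e.2

theorem mem_cutEdges_iff (A : Set V) (e : G.edgeSet) :
    e.1 ∈ cutEdges (G := G) A ↔
      ¬ ((toMultigraph G).src e ∈ A ↔ (toMultigraph G).tgt e ∈ A) := by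
  constructor
  · rintro ⟨a, ha, b, hb, hab, h⟩ hiff
    rw [← mk_src_tgt] at h
    rcases Sym2.eq_iff.1 h with ⟨h1, h2⟩ | ⟨h1, h2⟩ <;> rw [h1, h2] at hiff <;> tauto
  · intro h
    by_cases h1 : (toMultigraph G).src e ∈ A
    · exact ⟨_, h1, _, fun h2 => h (by tauto), adj_src_tgt e, (mk_src_tgt e).symm⟩
    · exact ⟨_, by tauto, _, h1, (adj_src_tgt e).symm, by rw [Sym2.eq_swap, mk_src_tgt]⟩

theorem exists_edge_of_adj {v w : V} (h : G.Adj v w) :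
    ∃ e : G.edgeSet, e.1 = s(v, w) ∧
      ((toMultigraph G).src e = v ∧ (toMultigraph G).tgt e = w ∨
        (toMultigraph G).src e = w ∧ (toMultigraph G).tgt e = v) :=
  ⟨⟨s(v, w), h⟩, rfl, Sym2.eq_iff.1 (mk_src_tgt (G := G) ⟨s(v, w), h⟩)⟩

/-! ### Topological components of the 1-complex minus sets of inner points -/

section Component

variable {S : Set (Realization V G.edgeSet)} {p q : Realization V G.edgeSet}

theorem mem_component_self (hp : p ∈ S) : p ∈ component G S p :=
  let := (toMultigraph G).complexTopology
  mem_connectedComponentIn hp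

theorem component_subset : component G S p ⊆ S :=
  let := (toMultigraph G).complexTopology
  connectedComponentIn_subset S p

theorem component_eq (h : q ∈ component G S p) : component G S p = component G S q :=
  let := (toMultigraph G).complexTopology
  connectedComponentIn_eq h

/-- By convention `connectedComponentIn` is empty when the base point lies outside the set. -/
theorem mem_of_mem_component (h : q ∈ component G S p) : p ∈ S := by
  let := (toMultigraph G).complexTopology
  exact connectedComponentIn_nonempty_iff.1 ⟨q, h⟩

theorem isPreconnected_component :
    @IsPreconnected _ (toMultigraph G).complexTopology (component G S p) :=
  let := (toMultigraph G).complexTopology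
  isPreconnected_connectedComponentIn

theorem subset_component {T : Set (Realization V G.edgeSet)}
    (hT : @IsPreconnected _ (toMultigraph G).complexTopology T) (hTS : T ⊆ S) (hqT : q ∈ T)
    (hq : q ∈ component G S p) : T ⊆ component G S p := by
  let := (toMultigraph G).complexTopology
  rw [component_eq hq]
  exact hT.subset_connectedComponentIn hqT hTS

theorem edgePoint_mem_component {e : G.edgeSet} {a b : unitInterval}
    (h : ∀ t ∈ uIcc a b, (toMultigraph G).edgePoint e t ∈ S)
    (ha : (toMultigraph G).edgePoint e a ∈ component G S p) :
    (toMultigraph G).edgePoint e b ∈ component G S p := by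
  let := (toMultigraph G).complexTopology
  refine subset_component (isPreconnected_uIcc.image _
    ((toMultigraph G).continuous_edgePoint e).continuousOn) ?_
    (mem_image_of_mem _ left_mem_uIcc) ha (mem_image_of_mem _ right_mem_uIcc)
  rintro _ ⟨t, ht, rfl⟩
  exact h t ht

variable {F : Set (Sym2 V)}

theorem edgePoint_mem_of_notMem (hS : (innerPoints G F)ᶜ ⊆ S) {e : G.edgeSet} (he : e.1 ∉ F)
    (t : unitInterval) : (toMultigraph G).edgePoint e t ∈ S := by
  apply hS
  rintro ⟨e', t', he', h⟩
  rcases Multigraph.unitInterval_cases t with rfl | rfl | ht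
  · rw [Multigraph.edgePoint_zero] at h; cases h
  · rw [Multigraph.edgePoint_one] at h; cases h
  · rw [Multigraph.edgePoint_inner _ _ _ ht] at h
    cases h
    exact he he'

/-- A walk in `G - F` runs along closed edges contained in `S`. Only an inclusion is assumed of `S`,
so that it can be the complement of finitely many points (ETOP) or of whole open edges (FCTOP). -/
theorem vertex_mem_component_of_reachable (hS : (innerPoints G F)ᶜ ⊆ S) {v w : V}
    (h : (G.deleteEdges F).Reachable v w) (hv : .vertex v ∈ component G S p) :
    .vertex w ∈ component G S p := by
  obtain ⟨r⟩ := h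
  induction r with
  | nil => exact hv
  | cons h r ih =>
    apply ih
    rw [SimpleGraph.deleteEdges_adj] at h
    obtain ⟨e, he, ⟨h1, h2⟩ | ⟨h1, h2⟩⟩ := exists_edge_of_adj h.1
    · rw [← h1, ← Multigraph.edgePoint_zero] at hv
      rw [← h2, ← Multigraph.edgePoint_one]
      exact edgePoint_mem_component
        (fun t _ => edgePoint_mem_of_notMem hS (he ▸ h.2) t) hv
    · rw [← h2, ← Multigraph.edgePoint_one] at hv
      rw [← h1, ← Multigraph.edgePoint_zero]
      exact edgePoint_mem_component
        (fun t _ => edgePoint_mem_of_notMem hS (he ▸ h.2) t) hv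

theorem vertex_notMem_innerPoints (v : V) : .vertex v ∉ innerPoints G F := by
  rintro ⟨e, t, -, h⟩
  cases h

theorem supp_subset_component (hS : (innerPoints G F)ᶜ ⊆ S) (v : V) :
    ((G.deleteEdges F).connectedComponentMk v).supp ⊆
      {w | .vertex w ∈ component G S (.vertex v)} := fun _ hw =>
  vertex_mem_component_of_reachable hS (SimpleGraph.ConnectedComponent.exact hw).symm
    (mem_component_self (hS (vertex_notMem_innerPoints v)))

theorem finite_edges_of_finite {X : Set (Realization V G.edgeSet)} (hX : X.Finite) :
    {e : G.edgeSet | ∃ t, .inner e t ∈ X}.Finite := by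
  refine (hX.biUnion (t := fun p => {e | ∃ t, p = .inner e t}) fun p _ => ?_).subset ?_
  · cases p with
    | vertex v => exact finite_empty.subset fun e ⟨t, h⟩ => by cases h
    | inner e t =>
      refine (finite_singleton e).subset fun e' ⟨t', h⟩ => ?_
      cases h
      rfl
  · rintro e ⟨t, ht⟩
    exact mem_iUnion₂.2 ⟨_, ht, t, rfl⟩

/-- Deleting every edge that meets `X` removes at least `X`; thus components of the graph minus
these edges lie inside topological components of the complement of `X`. -/
theorem compl_innerPoints_subset_compl {X : Set (Realization V G.edgeSet)}
    (hX : ∀ x ∈ X, ∃ e t, x = .inner e t) :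
    (innerPoints G (Subtype.val '' {e : G.edgeSet | ∃ t, .inner e t ∈ X}))ᶜ ⊆ Xᶜ := by
  rw [compl_subset_compl]
  intro x hx
  obtain ⟨e, t, rfl⟩ := hX x hx
  exact ⟨e, t, ⟨e, ⟨t, hx⟩, rfl⟩, rfl⟩

end Component

/-! ### Real coordinates on `‖G‖ ∪ Ω'(G)` -/

theorem height_inner (A : Set V) (e : G.edgeSet) (t : Ioo (0 : ℝ) 1) :
    (toMultigraph G).height A (.inner e t) = (1 - t) * A.indicator 1 ((toMultigraph G).src e) +
      t * A.indicator 1 ((toMultigraph G).tgt e) := rfl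

open Classical in
/-- The extension of the height function of a finite cut to the edge-ends. -/
def sideFun (A : Set V) : EndSpace G → ℝ
  | .inl p => (toMultigraph G).height A p
  | .inr ω => if ω.LivesIn A then 1 else 0

/-- The extension of the tent function on an edge to the edge-ends. -/
def bumpFun (e : G.edgeSet) (s : Ioo (0 : ℝ) 1) : EndSpace G → ℝ
  | .inl p => bump e s p
  | .inr _ => 0

variable (G) in
/-- The index set of the coordinates: the sides of finite cuts, and the inner points of edges. -/
abbrev Coord : Type _ :=
  {A : Set V // (cutEdges (G := G) A).Finite} ⊕ (G.edgeSet × Ioo (0 : ℝ) 1)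

/-- The coordinate functions. -/
def coord : Coord G → EndSpace G → ℝ
  | .inl A => sideFun A.1
  | .inr x => bumpFun x.1 x.2

variable (G) in
/-- The topology on `‖G‖ ∪ Ω'(G)` induced by the coordinate functions. -/
abbrev coordTopology : TopologicalSpace (EndSpace G) :=
  ⨅ j, TopologicalSpace.induced (coord (G := G) j) inferInstance

theorem sideFun_mem_Icc (A : Set V) (x : EndSpace G) : sideFun A x ∈ Icc (0 : ℝ) 1 := by
  cases x with
  | inl p => exact (toMultigraph G).height_mem_Icc A p
  | inr ω => simp only [sideFun]; split_ifs <;> simp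

theorem sideFun_compl {A : Set V} (hA : (cutEdges (G := G) A).Finite) (x : EndSpace G) :
    sideFun Aᶜ x = 1 - sideFun A x := by
  cases x with
  | inl p => exact (toMultigraph G).height_compl A p
  | inr ω =>
    have := EdgeEnd.livesIn_compl_iff (ω := ω) hA
    by_cases h : ω.LivesIn A <;> simp [sideFun, h, this]

open Classical in
theorem sideFun_of_not_isInner (A : Set V) {x : EndSpace G} (hx : ¬ IsInner x) :
    sideFun A x = if OnSide A x then 1 else 0 := by
  rcases x with (v | ⟨e, t⟩) | ω
  · by_cases h : v ∈ A <;> simp [sideFun, Multigraph.height, OnSide, h]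
  · exact absurd trivial hx
  · rfl

theorem bumpFun_of_not_isInner (e : G.edgeSet) (s : Ioo (0 : ℝ) 1) {x : EndSpace G}
    (hx : ¬ IsInner x) : bumpFun e s x = 0 := by
  rcases x with (v | ⟨e, t⟩) | ω
  · rfl
  · exact absurd trivial hx
  · rfl

theorem bumpFun_mem_Icc (e : G.edgeSet) (s : Ioo (0 : ℝ) 1) (x : EndSpace G) :
    bumpFun e s x ∈ Icc (0 : ℝ) 1 := by
  cases x with
  | inl p => exact bump_mem_Icc e s p
  | inr ω => simp [bumpFun]

theorem eq_of_bumpFun_eq_one {e : G.edgeSet} {s : Ioo (0 : ℝ) 1} {x : EndSpace G}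
    (h : bumpFun e s x = 1) : x = .inl (.inner e s) := by
  cases x with
  | inl p => exact congrArg _ (eq_of_bump_eq_one h)
  | inr ω => simp [bumpFun] at h

/-- Two points have the same coordinates iff they are equal or not separated by a finite cut. -/
theorem cutSetoid_iff_coord_eq (x y : EndSpace G) :
    (cutSetoid G).r x y ↔ ∀ j, coord j x = coord j y := by
  constructor
  · rintro (rfl | ⟨hx, hy, h⟩) (⟨A, hA⟩ | ⟨e, s⟩)
    · rfl
    · rfl
    · have := h A hA
      simp only [coord, sideFun_of_not_isInner _ hx, sideFun_of_not_isInner _ hy]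
      by_cases h1 : OnSide A y <;> simp [h1, this]
    · simp only [coord, bumpFun_of_not_isInner _ _ hx, bumpFun_of_not_isInner _ _ hy]
  · intro h
    -- The tent with peak at an inner point takes the value 1 only there.
    have key : ∀ {x y : EndSpace G}, (∀ j, coord j x = coord j y) → IsInner x → x = y := by
      intro x y h hx
      rcases x with (v | ⟨e, t⟩) | ω
      · exact hx.elim
      · refine (eq_of_bumpFun_eq_one (e := e) (s := t) ?_).symm
        exact (h (.inr (e, t))).symm.trans ((bump_inner_self (W := V) e t t).trans (tent_self t.2))
      · exact hx.elim
    by_cases hx : IsInner x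
    · exact Or.inl (key h hx)
    by_cases hy : IsInner y
    · exact Or.inl (key (fun j => (h j).symm) hy).symm
    refine Or.inr ⟨hx, hy, fun A hA => ?_⟩
    have := h (.inl ⟨A, hA⟩)
    simp only [coord, sideFun_of_not_isInner _ hx, sideFun_of_not_isInner _ hy] at this
    by_cases h1 : OnSide A x <;> by_cases h2 : OnSide A y <;> simp [h1, h2] at this ⊢

/-! ### Open and closed sets of the coordinate topology. -/

theorem isOpen_coord_preimage (j : Coord G) {U : Set ℝ} (hU : IsOpen U) :
    IsOpen[coordTopology G] (coord j ⁻¹' U) :=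
  iInf_le (fun j => TopologicalSpace.induced (coord (G := G) j) _) j _ ⟨U, hU, rfl⟩

theorem isClosed_coord_preimage (j : Coord G) {U : Set ℝ} (hU : IsClosed U) :
    IsClosed[coordTopology G] (coord j ⁻¹' U) := by
  let := coordTopology G
  exact isOpen_compl_iff.1 (isOpen_coord_preimage j hU.isOpen_compl)

theorem isOpen_coordTopology_onEdge (e : G.edgeSet) {U : Set (Ioo (0 : ℝ) 1)} (hU : IsOpen U) :
    IsOpen[coordTopology G] (onEdge e U) := by
  let := coordTopology G
  refine isOpen_iff_forall_mem_open.2 ?_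
  rintro _ ⟨s, hs, rfl⟩
  obtain ⟨O, hO, rfl⟩ := isOpen_induced_iff.1 hU
  obtain ⟨ε, hε, hεO⟩ := Metric.isOpen_iff.1 hO s hs
  -- A tent value this close to 1 forces the parameter to within `ε` of `s`. The minimum with 1
  -- keeps the threshold nonnegative, which excludes all points off the edge `e`.
  refine ⟨coord (.inr (e, s)) ⁻¹' Ioi (1 - min ε 1), ?_,
    isOpen_coord_preimage _ isOpen_Ioi, ?_⟩
  · have hε1 : 0 < min ε 1 := lt_min hε one_pos
    intro x hx
    replace hx : 1 - min ε 1 < bumpFun e s x := hx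
    have h0 : 0 < bumpFun e s x := lt_of_le_of_lt (by linarith [min_le_right ε 1]) hx
    rcases x with (v | ⟨e', t⟩) | ω
    · exact absurd h0 (lt_irrefl _)
    · simp only [bumpFun, bump] at hx h0
      split_ifs at hx h0 with he
      · subst he
        refine ⟨t, hεO ?_, rfl⟩
        rw [lt_tent_iff s.2] at hx
        have hs := s.2
        have h1 : min ε 1 * s < ε := by
          nlinarith [min_le_left ε 1, hs.1, hs.2, min_le_left ε 1]
        have h2 : min ε 1 * (1 - s) < ε := by
          nlinarith [min_le_left ε 1, hs.1, hs.2, min_le_left ε 1]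
        rw [Metric.mem_ball, Real.dist_eq, abs_lt]
        constructor <;> nlinarith
      · exact absurd h0 (lt_irrefl _)
    · exact absurd h0 (lt_irrefl _)
  · change 1 - min ε 1 < bump (W := V) e s (.inner e s)
    rw [bump_inner_self, tent_self s.2]
    linarith [lt_min hε one_pos]

theorem isClosed_coordTopology_onEdge_Icc (e : G.edgeSet) (a b : Ioo (0 : ℝ) 1) :
    IsClosed[coordTopology G] (onEdge e (Icc a b)) := by
  let := coordTopology G
  rcases lt_or_ge b a with hab | hab
  · have : onEdge e (Icc a b) = ∅ := by
      rw [Icc_eq_empty hab.not_ge]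
      exact eq_empty_of_forall_notMem fun x ⟨t, ht, _⟩ => ht
    rw [this]
    exact isClosed_empty
  · have ha := a.2
    have hb := b.2
    have hab' : (a : ℝ) ≤ b := hab
    -- Solving `c * s = a` and `1 - c * (1 - s) = b` gives the level `c = 1 - b + a` and the peak `s
    -- = a / c` of a tent whose superlevel set is exactly the segment.
    have hc : 0 < 1 - (b : ℝ) + a := by linarith [ha.1, hb.2]
    have hs : (a : ℝ) / (1 - b + a) ∈ Ioo (0 : ℝ) 1 :=
      ⟨div_pos ha.1 hc, (div_lt_one hc).2 (by linarith [hb.2])⟩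
    have h1 : (1 - (b : ℝ) + a) * (a / (1 - b + a)) = a := by field_simp
    have : onEdge e (Icc a b) = coord (.inr (e, ⟨_, hs⟩)) ⁻¹' Ici (1 - (b : ℝ) + a) := by
      ext x
      constructor
      · rintro ⟨t, ht, rfl⟩
        change 1 - (b : ℝ) + a ≤ bump (W := V) e ⟨_, hs⟩ (.inner e t)
        rw [bump_inner_self, le_tent_iff hs, mul_sub, h1]
        exact ⟨ht.1, by linarith [show (t : ℝ) ≤ b from ht.2]⟩
      · intro hx
        replace hx : 1 - (b : ℝ) + a ≤ bumpFun e ⟨_, hs⟩ x := hx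
        rcases x with (v | ⟨e', t⟩) | ω
        · exact absurd hx hc.not_ge
        · simp only [bumpFun, bump] at hx
          split_ifs at hx with he
          · subst he
            rw [le_tent_iff hs, mul_sub, h1] at hx
            exact ⟨t, ⟨hx.1, show (t : ℝ) ≤ b by linarith [hx.2]⟩, rfl⟩
          · exact absurd hx hc.not_ge
        · exact absurd hx hc.not_ge
    rw [this]
    exact isClosed_coord_preimage _ isClosed_Ici

/-- Continuity of a function into `[0,1]` can be tested on open rays at values in `(0,1)`. -/
theorem continuous_of_isOpen_levels {X : Type*} [TopologicalSpace X] {k : X → ℝ}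
    (hk : ∀ x, k x ∈ Icc (0 : ℝ) 1)
    (h : ∀ c ∈ Ioo (0 : ℝ) 1, IsOpen {x | c < k x} ∧ IsOpen {x | k x < c}) : Continuous k := by
  have key : ∀ f : X → ℝ, (∀ x, f x ∈ Icc (0 : ℝ) 1) →
      (∀ c ∈ Ioo (0 : ℝ) 1, IsOpen {x | c < f x}) → ∀ c, IsOpen {x | c < f x} := by
    intro f hf h c
    rcases lt_or_ge c 0 with hc | hc
    · convert isOpen_univ
      exact eq_univ_of_forall fun x => hc.trans_le (hf x).1
    rcases lt_or_ge c 1 with hc1 | hc1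
    -- The union is needed for `c = 0`, which is not among the given levels.
    · have : {x | c < f x} = ⋃ d ∈ Ioo c 1, {x | d < f x} := by
        ext x
        simp only [mem_iUnion, exists_prop]
        constructor
        · intro hx
          obtain ⟨d, hd, hdx⟩ := exists_between (show c < f x from hx)
          exact ⟨d, ⟨hd, hdx.trans_le (hf x).2⟩, hdx⟩
        · rintro ⟨d, hd, hdx⟩
          exact hd.1.trans hdx
      rw [this]
      exact isOpen_biUnion fun d hd => h d ⟨hc.trans_lt hd.1, hd.2⟩
    · convert isOpen_empty
      exact eq_empty_of_forall_notMem fun x hx => (hc1.trans_lt hx).not_ge (hf x).2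
  have h1 := key k hk fun c hc => (h c hc).1
  have h2 := key (fun x => 1 - k x)
    (fun x => ⟨sub_nonneg.2 (hk x).2, sub_le_self _ (hk x).1⟩) fun c hc => by
      have := (h (1 - c) ⟨sub_pos.2 hc.2, sub_lt_self _ hc.1⟩).2
      simpa only [lt_sub_comm] using this
  rw [OrderTopology.topology_eq_generate_intervals (α := ℝ), continuous_generateFrom_iff]
  rintro _ ⟨c, rfl | rfl⟩
  · exact h1 c
  · have := h2 (1 - c)
    simp only [sub_lt_sub_iff_left] at this
    exact this

/-! ### ETOP is induced by the coordinates -/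

theorem finite_inner {F : Set G.edgeSet} (hF : F.Finite) {T : Set ℝ} (hT : T.Finite) :
    {p : Realization V G.edgeSet |
      ∃ (e : G.edgeSet) (t : Ioo (0 : ℝ) 1), e ∈ F ∧ (t : ℝ) ∈ T ∧ p = .inner e t}.Finite := by
  have hT' : ((↑) ⁻¹' T : Set (Ioo (0 : ℝ) 1)).Finite := hT.preimage Subtype.val_injective.injOn
  refine ((hF.prod hT').image fun x => Realization.inner x.1 x.2).subset ?_
  rintro _ ⟨e, t, he, ht, rfl⟩
  exact ⟨(e, t), ⟨he, ht⟩, rfl⟩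

/-- The level set at `c` is a finite set of inner points, hence an admissible `X` for ETOP. By the
intermediate value property `k - c` has constant sign on each component of its complement, and `hgt`
and `hlt` carry the sign over to the edge-ends living there. -/
theorem isOpen_etop_gt {k : EndSpace G → ℝ} {c : ℝ}
    (hk : Continuous[(toMultigraph G).complexTopology, _] fun p => k (.inl p))
    {F : Set G.edgeSet} (hF : F.Finite) {T : Set ℝ} (hT : T.Finite)
    (hlevel : ∀ p, k (.inl p) = c →
      ∃ (e : G.edgeSet) (t : Ioo (0 : ℝ) 1), e ∈ F ∧ (t : ℝ) ∈ T ∧ p = .inner e t)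
    (hgt : ∀ (ω : EdgeEnd G) S, ω.LivesIn S → (∀ v ∈ S, c < k (.inl (.vertex v))) → c < k (.inr ω))
    (hlt : ∀ (ω : EdgeEnd G) S, ω.LivesIn S → (∀ v ∈ S, k (.inl (.vertex v)) < c) →
      k (.inr ω) < c) :
    IsOpen[etop G] {x | c < k x} := by
  let := etop G
  let := (toMultigraph G).complexTopology
  let X : Set (Realization V G.edgeSet) := {p | k (.inl p) = c}
  have hX : X.Finite := (finite_inner hF hT).subset hlevel
  have hXi : ∀ x ∈ X, ∃ e t, x = Realization.inner e t := fun x hx => by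
    obtain ⟨e, t, -, -, h⟩ := hlevel x hx
    exact ⟨e, t, h⟩
  have hconn : ∀ p, ∀ q ∈ component G Xᶜ p, (c < k (.inl p) ↔ c < k (.inl q)) := by
    intro p q hq
    have hp : p ∈ component G Xᶜ p := mem_component_self (mem_of_mem_component hq)
    have himg := (isPreconnected_component (S := Xᶜ) (p := p)).image (fun p => k (.inl p))
      hk.continuousOn
    have hc : c ∉ (fun p => k (.inl p)) '' component G Xᶜ p := by
      rintro ⟨r, hr, h⟩
      exact component_subset hr h
    by_contra hne
    rcases lt_or_ge c (k (.inl p)) with h | h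
    · have h' : k (.inl q) ≤ c := by by_contra! h'; exact hne (by tauto)
      exact hc (himg.ordConnected.out (mem_image_of_mem _ hq) (mem_image_of_mem _ hp) ⟨h', h.le⟩)
    · have h' : c < k (.inl q) := by by_contra h'; exact hne (by simp [h', h.not_gt])
      exact hc (himg.ordConnected.out (mem_image_of_mem _ hp) (mem_image_of_mem _ hq) ⟨h, h'.le⟩)
  have hends : ∀ p, c < k (.inl p) → withEnds (component G Xᶜ p) ⊆ {x | c < k x} := by
    rintro p hp (q | ω) hx
    · exact (hconn p q hx).1 hp
    · exact hgt ω _ hx fun v hv => (hconn p _ hv).1 hp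
  have hopen : ∀ p, c < k (.inl p) → IsOpen (withEnds (component G Xᶜ p)) := fun p hp =>
    TopologicalSpace.isOpen_generateFrom_of_mem (Or.inr ⟨X, hX, hXi, p, fun h => hp.ne' h, rfl⟩)
  refine isOpen_iff_forall_mem_open.2 ?_
  rintro (p | ω) hx
  · refine ⟨_, hends p hx, hopen p hx, ?_⟩
    have hp : p ∈ Xᶜ := fun h => (show c < k (.inl p) from hx).ne' h
    exact mem_component_self hp
  -- The edge-end lives in a component of `G` minus the edges meeting `X`, hence in the topological
  -- component of some vertex `v`; by `hlt`, `k` exceeds `c` at `v`.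
  · obtain ⟨v, hv⟩ := ω.exists_livesIn_component
      ((finite_edges_of_finite hX).image Subtype.val)
    have hvω := hv.mono (supp_subset_component (compl_innerPoints_subset_compl hXi) v)
    have hvX : Realization.vertex v ∈ Xᶜ := by
      obtain ⟨w, hw⟩ := hvω.nonempty
      exact mem_of_mem_component hw
    have hcv : c < k (.inl (.vertex v)) := by
      by_contra hcv
      refine (hlt ω _ hvω fun w hw => ?_).not_gt hx
      exact lt_of_le_of_ne (not_lt.1 fun h => hcv ((hconn _ _ hw).2 h)) (component_subset hw)
    exact ⟨_, hends _ hcv, hopen _ hcv, hvω⟩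

theorem finite_edges_in {C : Set (Sym2 V)} (hC : C.Finite) : {e : G.edgeSet | e.1 ∈ C}.Finite :=
  hC.preimage Subtype.val_injective.injOn

theorem isOpen_etop_sideFun {A : Set V} (hA : (cutEdges (G := G) A).Finite) {c : ℝ}
    (hc : c ∈ Ioo (0 : ℝ) 1) : IsOpen[etop G] {x | c < sideFun A x} := by
  -- Value `c` occurs only on cut edges, at parameter `c` if the target lies in `A` and at `1 - c`
  -- if the source does.
  refine isOpen_etop_gt ((toMultigraph G).continuous_height A) (finite_edges_in hA)
    (T := {c, 1 - c}) (by simp) ?_ ?_ ?_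
  · rintro (v | ⟨e, t⟩) hp
    · by_cases hv : v ∈ A <;> simp [sideFun, Multigraph.height, hv] at hp
      · exact absurd hp hc.2.ne'
      · exact absurd hp hc.1.ne
    · refine ⟨e, t, (mem_cutEdges_iff A e).2 fun h => ?_, ?_, rfl⟩
      · simp only [sideFun, height_inner] at hp
        by_cases h1 : (toMultigraph G).src e ∈ A <;> simp [h1, ← h] at hp
        · exact hc.2.ne' hp
        · exact hc.1.ne hp
      · simp only [sideFun, height_inner] at hp
        by_cases h1 : (toMultigraph G).src e ∈ A <;>
          by_cases h2 : (toMultigraph G).tgt e ∈ A <;> simp [h1, h2] at hp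
        · exact absurd hp hc.2.ne'
        · exact Or.inr (by simp only [mem_singleton_iff]; linarith)
        · exact Or.inl hp
        · exact absurd hp hc.1.ne
  · intro ω S hS h
    have : ω.LivesIn A := hS.mono fun v hv => by
      by_contra hvA
      have := h v hv
      simp [sideFun, Multigraph.height, hvA] at this
      exact absurd hc.1 this.not_gt
    simp [sideFun, this, hc.2]
  · intro ω S hS h
    have : ω.LivesIn Aᶜ := hS.mono fun v hv hvA => by
      have := h v hv
      simp [sideFun, Multigraph.height, hvA] at this
      exact absurd hc.2 this.not_gt
    rw [EdgeEnd.livesIn_compl_iff hA] at this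
    simp [sideFun, this, hc.1]

theorem bump_eq {e : G.edgeSet} {s : Ioo (0 : ℝ) 1} {c : ℝ} (hc : 0 < c)
    {p : Realization V G.edgeSet} (hp : bump e s p = c) :
    ∃ (e' : G.edgeSet) (t : Ioo (0 : ℝ) 1), e' ∈ ({e} : Set G.edgeSet) ∧
      (t : ℝ) ∈ ({c * s, 1 - c * (1 - s)} : Set ℝ) ∧ p = .inner e' t := by
  rcases p with v | ⟨e', t⟩
  · exact absurd hp hc.ne
  · simp only [bump] at hp
    split_ifs at hp with he
    · exact ⟨e', t, he, tent_eq s.2 hp, rfl⟩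
    · exact absurd hp hc.ne

theorem isOpen_etop_bumpFun (e : G.edgeSet) (s : Ioo (0 : ℝ) 1) {c : ℝ} (hc : 0 < c) :
    IsOpen[etop G] {x | c < bumpFun e s x} ∧ IsOpen[etop G] {x | bumpFun e s x < c} := by
  constructor
  · refine isOpen_etop_gt ((toMultigraph G).continuous_bump e s) (finite_singleton e)
      (T := {c * s, 1 - c * (1 - s)}) (by simp) (fun p hp => bump_eq hc hp) ?_ ?_
    · intro ω S hS h
      obtain ⟨v, hv⟩ := hS.nonempty
      exact h v hv
    · intro ω S hS h
      exact hc
  · let := (toMultigraph G).complexTopology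
    have := isOpen_etop_gt (k := fun x => - bumpFun e s x) (c := -c)
      (continuous_neg.comp ((toMultigraph G).continuous_bump e s)) (finite_singleton e)
      (T := {c * s, 1 - c * (1 - s)}) (by simp) (fun p hp => bump_eq hc (neg_inj.1 hp)) ?_ ?_
    · simpa only [neg_lt_neg_iff] using this
    · intro ω S hS h
      simpa [bumpFun] using hc
    · intro ω S hS h
      obtain ⟨v, hv⟩ := hS.nonempty
      exact h v hv

theorem lt_sideFun_iff {A : Set V} (hA : (cutEdges (G := G) A).Finite) (c : ℝ) :
    {x : EndSpace G | sideFun A x < c} = {x | 1 - c < sideFun Aᶜ x} := by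
  ext x
  simp only [mem_ofPred_eq, sideFun_compl hA, sub_lt_sub_iff_left]

/-- For sides, superlevel sets suffice: the complement of `A` is a side of the same cut and has
coordinate `1 - sideFun A`. -/
theorem le_coordTopology {t : TopologicalSpace (EndSpace G)}
    (hside : ∀ A : Set V, (cutEdges (G := G) A).Finite → ∀ c ∈ Ioo (0 : ℝ) 1,
      IsOpen[t] {x | c < sideFun A x})
    (hbump : ∀ (e : G.edgeSet) (s : Ioo (0 : ℝ) 1), ∀ c ∈ Ioo (0 : ℝ) 1,
      IsOpen[t] {x | c < bumpFun e s x} ∧ IsOpen[t] {x | bumpFun e s x < c}) :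
    t ≤ coordTopology G := by
  refine le_iInf fun j => continuous_iff_le_induced.1 ?_
  rcases j with ⟨A, hA⟩ | ⟨e, s⟩
  · refine continuous_of_isOpen_levels (sideFun_mem_Icc A) fun c hc => ⟨hside A hA c hc, ?_⟩
    change IsOpen[t] {x | sideFun A x < c}
    rw [lt_sideFun_iff hA]
    exact hside Aᶜ (by rwa [cutEdges_compl]) _ ⟨sub_pos.2 hc.2, sub_lt_self _ hc.1⟩
  · exact continuous_of_isOpen_levels (bumpFun_mem_Icc e s) (hbump e s)

theorem etop_le_coordTopology : etop G ≤ coordTopology G :=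
  le_coordTopology (fun _ hA _ hc => isOpen_etop_sideFun hA hc)
    fun e s _ hc => isOpen_etop_bumpFun e s hc.1

/-- A neighbourhood in the coordinate topology of a vertex, or of an edge-end living in its
component, that lies in the topological component of the vertex. -/
theorem exists_coord_nhds {X : Set (Realization V G.edgeSet)} (hX : X.Finite)
    (hXi : ∀ x ∈ X, ∃ e t, x = .inner e t) (v : V) :
    ∃ N, IsOpen[coordTopology G] N ∧ .inl (.vertex v) ∈ N ∧
      (∀ ω : EdgeEnd G, ω.LivesIn ((G.deleteEdges (Subtype.val ''
        {e : G.edgeSet | ∃ t, .inner e t ∈ X})).connectedComponentMk v).supp → .inr ω ∈ N) ∧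
      N ⊆ withEnds (component G Xᶜ (.vertex v)) := by
  let := coordTopology G
  set FX : Set G.edgeSet := {e : G.edgeSet | ∃ t, .inner e t ∈ X} with hFX
  have hFXf : FX.Finite := finite_edges_of_finite hX
  set K := ((G.deleteEdges (Subtype.val '' FX)).connectedComponentMk v).supp with hK
  have hcut : cutEdges (G := G) K ⊆ Subtype.val '' FX := cutEdges_supp_subset _
  have hcutf : (cutEdges (G := G) K).Finite := (hFXf.image _).subset hcut
  have hS := compl_innerPoints_subset_compl hXi
  have hKc : K ⊆ {w | .vertex w ∈ component G Xᶜ (.vertex v)} := supp_subset_component hS v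
  -- No point of `X` is within `δ` of an end of its edge.
  obtain ⟨δ, hδ, hδ0⟩ : ∃ δ : ℝ, (δ < 1 / 2 ∧ ∀ x ∈ X, ∀ e t, x = Realization.inner e t →
      δ < t ∧ δ < 1 - t) ∧ 0 < δ := by
    have : ∀ᶠ δ : ℝ in 𝓝[>] 0, (δ < 1 / 2 ∧ ∀ x ∈ X, ∀ e t, x = Realization.inner e t →
        δ < t ∧ δ < 1 - t) := by
      refine (eventually_nhdsWithin_of_eventually_nhds (eventually_lt_nhds (by norm_num))).and
        ((Filter.eventually_all_finite hX).2 fun x hx => ?_)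
      obtain ⟨e, t, rfl⟩ := hXi x hx
      filter_upwards [eventually_nhdsWithin_of_eventually_nhds (eventually_lt_nhds t.2.1),
        eventually_nhdsWithin_of_eventually_nhds (eventually_lt_nhds (sub_pos.2 t.2.2))]
        with δ h1 h2 e' t' h
      cases h
      exact ⟨h1, h2⟩
    exact (this.and self_mem_nhdsWithin).exists
  have hhalf : (1 / 2 : ℝ) ∈ Ioo (0 : ℝ) 1 := by constructor <;> norm_num
  -- The side coordinate alone does not control an edge of `FX` with both ends in `K`. There the
  -- tent with peak `1 / 2` being below `2 * δ` keeps the point within `δ` of an end, so no point of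
  -- `X` lies between.
  refine ⟨coord (.inl ⟨K, hcutf⟩) ⁻¹' Ioi (1 - δ) ∩
    ⋂ e ∈ FX, coord (.inr (e, ⟨1 / 2, hhalf⟩)) ⁻¹' Iio (2 * δ), ?_, ?_, ?_, ?_⟩
  · exact (isOpen_coord_preimage _ isOpen_Ioi).inter
      (hFXf.isOpen_biInter fun e _ => isOpen_coord_preimage _ isOpen_Iio)
  · refine ⟨?_, mem_iInter₂.2 fun e _ => ?_⟩
    · have hv : v ∈ K := rfl
      simp [coord, sideFun, Multigraph.height, hv, hδ0]
    · simp [coord, bumpFun, bump, hδ0]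
  · intro ω hω
    refine ⟨?_, mem_iInter₂.2 fun e _ => ?_⟩
    · simp [coord, sideFun, hω, hδ0]
    · simp [coord, bumpFun, hδ0]
  · rintro ((w | ⟨e, t⟩) | ω) ⟨h1, h2⟩
    · by_cases hw : w ∈ K
      · exact hKc hw
      · simp [coord, sideFun, Multigraph.height, hw] at h1
        linarith [hδ.1]
    · have h1 : 1 - δ < (toMultigraph G).height K (.inner e t) := h1
      have htI : (t : ℝ) ∈ Icc (0 : ℝ) 1 := ⟨t.2.1.le, t.2.2.le⟩
      have hte : (toMultigraph G).edgePoint e ⟨t, htI⟩ = .inner e t :=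
        (toMultigraph G).edgePoint_inner e _ t.2
      have hsub : ∀ u : unitInterval, (toMultigraph G).edgePoint e u ∈ X →
          e ∈ FX ∧ δ < u ∧ δ < 1 - (u : ℝ) := by
        intro u hu
        rcases Multigraph.unitInterval_cases u with rfl | rfl | hu'
        · rw [Multigraph.edgePoint_zero] at hu
          obtain ⟨e', t', h⟩ := hXi _ hu
          cases h
        · rw [Multigraph.edgePoint_one] at hu
          obtain ⟨e', t', h⟩ := hXi _ hu
          cases h
        · rw [Multigraph.edgePoint_inner _ _ _ hu'] at hu
          exact ⟨⟨_, hu⟩, hδ.2 _ hu _ _ rfl⟩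
      have h2' : e ∈ FX → ((t : ℝ) < δ ∨ 1 - (t : ℝ) < δ) := by
        intro he
        have h := mem_iInter₂.1 h2 e he
        have h : bump (W := V) e ⟨1 / 2, hhalf⟩ (.inner e t) < 2 * δ := h
        rw [bump_inner_self, ← not_le, le_tent_iff hhalf] at h
        by_contra! h'
        exact h ⟨by linarith, by linarith⟩
      have hfrom_src : (toMultigraph G).src e ∈ K → (e ∈ FX → (t : ℝ) < δ) →
          .inner e t ∈ component G Xᶜ (.vertex v) := by
        intro hs ht
        rw [← hte]
        refine edgePoint_mem_component (a := 0) (fun u hu huX => ?_)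
          (by rw [Multigraph.edgePoint_zero]; exact hKc hs)
        obtain ⟨he, hu1, hu2⟩ := hsub u huX
        rw [uIcc_of_le (show (0 : unitInterval) ≤ _ from unitInterval.nonneg')] at hu
        have : (u : ℝ) ≤ t := hu.2
        linarith [ht he]
      have hfrom_tgt : (toMultigraph G).tgt e ∈ K → (e ∈ FX → 1 - (t : ℝ) < δ) →
          .inner e t ∈ component G Xᶜ (.vertex v) := by
        intro hs ht
        rw [← hte]
        refine edgePoint_mem_component (a := 1) (fun u hu huX => ?_)
          (by rw [Multigraph.edgePoint_one]; exact hKc hs)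
        obtain ⟨he, hu1, hu2⟩ := hsub u huX
        rw [uIcc_of_ge (show _ ≤ (1 : unitInterval) from unitInterval.le_one')] at hu
        have : (t : ℝ) ≤ u := hu.1
        linarith [ht he]
      change Realization.inner e t ∈ component G Xᶜ (.vertex v)
      rw [height_inner] at h1
      by_cases hs : (toMultigraph G).src e ∈ K <;> by_cases ht : (toMultigraph G).tgt e ∈ K <;>
        simp [hs, ht] at h1
      · by_cases he : e ∈ FX
        · exact (h2' he).elim (fun h => hfrom_src hs fun _ => h) fun h => hfrom_tgt ht fun _ => h
        · exact hfrom_src hs fun h => absurd h he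
      · exact hfrom_src hs fun _ => h1
      · exact hfrom_tgt ht fun _ => by linarith
      · linarith [hδ.1]
    · have h1 : 1 - δ < sideFun K (.inr ω) := h1
      by_cases hω : ω.LivesIn K
      · exact hω.mono hKc
      · simp [sideFun, hω] at h1
        linarith [hδ.1]

theorem cutEdges_component_subset {S : Set (Realization V G.edgeSet)} {F : Set (Sym2 V)}
    (hS : (innerPoints G F)ᶜ ⊆ S) (p : Realization V G.edgeSet) :
    cutEdges (G := G) {w | .vertex w ∈ component G S p} ⊆ F := by
  rintro _ ⟨a, ha, b, hb, hab, rfl⟩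
  by_contra h
  have : (G.deleteEdges F).Adj a b := by
    rw [SimpleGraph.deleteEdges_adj]
    exact ⟨hab, h⟩
  exact hb (vertex_mem_component_of_reachable hS this.reachable ha)

theorem coordTopology_le_etop : coordTopology G ≤ etop G := by
  refine le_generateFrom ?_
  let := coordTopology G
  rintro O (⟨e, U, hU, rfl⟩ | ⟨X, hX, hXi, p, -, rfl⟩)
  · exact isOpen_coordTopology_onEdge e hU
  · refine isOpen_iff_forall_mem_open.2 ?_
    rintro ((v | ⟨e, t⟩) | ω) hx
    · have hv : .vertex v ∈ component G Xᶜ p := hx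
      obtain ⟨N, hN, hvN, -, hNX⟩ := exists_coord_nhds hX hXi v
      rw [component_eq hv]
      exact ⟨N, hNX, hN, hvN⟩
    · have he : .inner e t ∈ component G Xᶜ p := hx
      rw [component_eq he]
      let T : Set (Ioo (0 : ℝ) 1) := {s | Realization.inner e s ∉ X}
      have hT : IsOpen T := by
        have : Tᶜ.Finite := by
          refine (hX.preimage (f := fun s : Ioo (0 : ℝ) 1 => Realization.inner e s)
            fun a _ b _ h => ?_).subset fun s hs => not_not.1 hs
          cases h
          rfl
        exact isClosed_compl_iff.1 this.isClosed
      have htT : t ∈ T := component_subset he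
      -- Local connectedness makes the component of `t` in `T` open; being connected, its image
      -- stays in the component of the given point.
      have : LocallyConnectedSpace (Ioo (0 : ℝ) 1) :=
        (isOpen_Ioo.isOpenEmbedding_subtypeVal).locallyConnectedSpace
      refine ⟨onEdge e (connectedComponentIn T t), ?_,
        isOpen_coordTopology_onEdge e hT.connectedComponentIn,
        ⟨t, mem_connectedComponentIn htT, rfl⟩⟩
      rintro _ ⟨s, hs, rfl⟩
      let := (toMultigraph G).complexTopology
      have hc : Continuous fun s : Ioo (0 : ℝ) 1 =>
          (Realization.inner e s : Realization V G.edgeSet) := by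
        have : (fun s : Ioo (0 : ℝ) 1 => (Realization.inner e s : Realization V G.edgeSet)) =
            (toMultigraph G).edgePoint e ∘ inclusion Ioo_subset_Icc_self :=
          funext fun s =>
            ((toMultigraph G).edgePoint_inner e ⟨s, s.2.1.le, s.2.2.le⟩ s.2).symm
        rw [this]
        exact ((toMultigraph G).continuous_edgePoint e).comp (continuous_inclusion _)
      refine subset_component (isPreconnected_connectedComponentIn.image _ hc.continuousOn) ?_
        (mem_image_of_mem _ (mem_connectedComponentIn htT))
        (mem_component_self (component_subset he)) (mem_image_of_mem _ hs)
      rintro _ ⟨u, hu, rfl⟩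
      exact connectedComponentIn_subset T t hu
    · have hω : ω.LivesIn {v | .vertex v ∈ component G Xᶜ p} := hx
      obtain ⟨v, hv⟩ := ω.exists_livesIn_component
        ((finite_edges_of_finite hX).image Subtype.val)
      have hvp : .vertex v ∈ component G Xᶜ p :=
        (EdgeEnd.livesIn_iff_mem ((finite_edges_of_finite hX).image _) hv
          (cutEdges_component_subset (compl_innerPoints_subset_compl hXi) p)).1 hω
      obtain ⟨N, hN, -, hωN, hNX⟩ := exists_coord_nhds hX hXi v
      rw [component_eq hvp]
      exact ⟨N, hNX, hN, hωN ω hv⟩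

theorem etop_eq_coordTopology : etop G = coordTopology G :=
  le_antisymm etop_le_coordTopology coordTopology_le_etop

/-! ### FCTOP is induced by the coordinates -/

/-- Away from the edges of `C` the height takes only the values 0 and 1, so it is constant on
connected sets. -/
theorem height_eq_of_mem_component {A : Set V} {C : Set (Sym2 V)}
    (hA : cutEdges (G := G) A ⊆ C) {p q : Realization V G.edgeSet}
    (hq : q ∈ component G (innerPoints G C)ᶜ p) :
    (toMultigraph G).height A q = (toMultigraph G).height A p := by
  let := (toMultigraph G).complexTopology
  refine isPreconnected_component.constant_of_mapsTo (T := {0, 1})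
    (toFinite _).isDiscrete ((toMultigraph G).continuous_height A).continuousOn ?_ hq
    (mem_component_self (mem_of_mem_component hq))
  intro r hr
  have hr := component_subset hr
  rcases r with v | ⟨e, t⟩
  · by_cases hv : v ∈ A <;> simp [Multigraph.height, hv]
  · have he : (toMultigraph G).src e ∈ A ↔ (toMultigraph G).tgt e ∈ A := by
      by_contra h
      exact hr ⟨e, t, hA ((mem_cutEdges_iff A e).2 h), rfl⟩
    by_cases h : (toMultigraph G).src e ∈ A <;> simp [height_inner, h, ← he]

theorem inner_mem_component_iff {C : Set (Sym2 V)} {p : Realization V G.edgeSet} {e : G.edgeSet}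
    (he : e.1 ∉ C) (t : Ioo (0 : ℝ) 1) :
    .inner e t ∈ component G (innerPoints G C)ᶜ p ↔
      .vertex ((toMultigraph G).src e) ∈ component G (innerPoints G C)ᶜ p := by
  rw [← Multigraph.edgePoint_zero,
    ← (toMultigraph G).edgePoint_inner e ⟨t, t.2.1.le, t.2.2.le⟩ t.2]
  exact ⟨edgePoint_mem_component fun u _ => edgePoint_mem_of_notMem subset_rfl he u,
    edgePoint_mem_component fun u _ => edgePoint_mem_of_notMem subset_rfl he u⟩

theorem exists_vertex_mem_component {C : Set (Sym2 V)} {p : Realization V G.edgeSet}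
    (hp : p ∉ innerPoints G C) : ∃ v, .vertex v ∈ component G (innerPoints G C)ᶜ p := by
  rcases p with v | ⟨e, t⟩
  · exact ⟨v, mem_component_self hp⟩
  · have he : e.1 ∉ C := fun he => hp ⟨e, t, he, rfl⟩
    exact ⟨_, (inner_mem_component_iff he t).1 (mem_component_self hp)⟩

section CutComponent

variable {C : Set (Sym2 V)} {v : V}

/-- The height function of the graph component separates it from all other vertices, so topological
and graph components have the same vertices. -/
theorem vertex_mem_component_iff {w : V} :
    .vertex w ∈ component G (innerPoints G C)ᶜ (.vertex v) ↔
      w ∈ ((G.deleteEdges C).connectedComponentMk v).supp := by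
  refine ⟨fun h => ?_, fun h => supp_subset_component subset_rfl v h⟩
  have := height_eq_of_mem_component
    (cutEdges_supp_subset ((G.deleteEdges C).connectedComponentMk v)) h
  by_contra hw
  simp [Multigraph.height, indicator_of_notMem hw] at this

/-- No edge of a cut has both ends in one component of the complement of the cut. -/
theorem not_both_ends_mem_supp (hC : ∃ A, cutEdges (G := G) A = C)
    (K : (G.deleteEdges C).ConnectedComponent) {e : G.edgeSet} (he : e.1 ∈ C) :
    ¬ ((toMultigraph G).src e ∈ K.supp ∧ (toMultigraph G).tgt e ∈ K.supp) := by
  rintro ⟨h1, h2⟩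
  obtain ⟨A, rfl⟩ := hC
  exact (mem_cutEdges_iff A e).1 he (mem_iff_of_mem_supp subset_rfl h1 h2)

/-- Here `C` has to be a cut: an edge of `C` with both ends in the component would have height 1 on
its removed inner points. -/
theorem mem_component_iff_height (hC : ∃ A, cutEdges (G := G) A = C)
    {q : Realization V G.edgeSet} :
    q ∈ component G (innerPoints G C)ᶜ (.vertex v) ↔
      (toMultigraph G).height ((G.deleteEdges C).connectedComponentMk v).supp q = 1 := by
  set K := (G.deleteEdges C).connectedComponentMk v with hK
  rcases q with w | ⟨e, t⟩
  · rw [vertex_mem_component_iff]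
    by_cases hw : w ∈ K.supp
    · simp only [Multigraph.height, indicator_of_mem hw, ← hK, hw, Pi.one_apply]
    · simp only [Multigraph.height, indicator_of_notMem hw, ← hK, hw, zero_ne_one]
  · by_cases he : e.1 ∈ C
    · refine ⟨fun h => absurd ⟨e, t, he, rfl⟩ (component_subset h), fun h => ?_⟩
      have := not_both_ends_mem_supp hC K he
      have h0 := t.2.1
      have h1 := t.2.2
      rw [height_inner] at h
      by_cases hs : (toMultigraph G).src e ∈ K.supp
      · have ht : (toMultigraph G).tgt e ∉ K.supp := fun ht => this ⟨hs, ht⟩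
        rw [indicator_of_mem hs, indicator_of_notMem ht] at h
        simp at h
        linarith
      · rw [indicator_of_notMem hs] at h
        by_cases ht : (toMultigraph G).tgt e ∈ K.supp
        · rw [indicator_of_mem ht] at h
          simp at h
          linarith
        · rw [indicator_of_notMem ht] at h
          simp at h
    · rw [inner_mem_component_iff he, vertex_mem_component_iff, ← hK, height_inner]
      have hiff : (toMultigraph G).src e ∈ K.supp ↔ (toMultigraph G).tgt e ∈ K.supp := by
        by_contra h
        exact he (cutEdges_supp_subset K ((mem_cutEdges_iff _ e).2 h))
      by_cases hs : (toMultigraph G).src e ∈ K.supp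
      · simp [indicator_of_mem (hiff.1 hs), hs]
      · simp [indicator_of_notMem (mt hiff.2 hs), hs]

theorem livesIn_component_iff {ω : EdgeEnd G} :
    ω.LivesIn {w | .vertex w ∈ component G (innerPoints G C)ᶜ (.vertex v)} ↔
      ω.LivesIn ((G.deleteEdges C).connectedComponentMk v).supp := by
  simp only [vertex_mem_component_iff]
  rfl

theorem withEnds_component_eq (hC : ∃ A, cutEdges (G := G) A = C) :
    withEnds (component G (innerPoints G C)ᶜ (.vertex v)) =
      {x | 1 ≤ sideFun ((G.deleteEdges C).connectedComponentMk v).supp x} := by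
  ext (q | ω)
  · change q ∈ component G _ _ ↔ 1 ≤ (toMultigraph G).height _ q
    rw [mem_component_iff_height hC]
    exact ⟨fun h => h.ge, fun h => le_antisymm ((toMultigraph G).height_mem_Icc _ q).2 h⟩
  · change EdgeEnd.LivesIn _ _ ↔ _
    rw [livesIn_component_iff]
    by_cases h : ω.LivesIn ((G.deleteEdges C).connectedComponentMk v).supp <;>
      simp [sideFun, h]

theorem withEnds_union_partialEdges {D : Set (Realization V G.edgeSet)}
    {c : G.edgeSet → Ioo (0 : ℝ) 1} :
    withEnds (D ∪ partialEdges G C D c) = withEnds D ∪ Sum.inl '' partialEdges G C D c := by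
  have h : {v | Realization.vertex v ∈ D ∪ partialEdges G C D c} = {v | .vertex v ∈ D} := by
    ext v
    refine ⟨fun h => h.resolve_right ?_, Or.inl⟩
    rintro ⟨e, t, -, h, -⟩
    cases h
  ext (q | ω)
  · refine or_congr Iff.rfl ⟨fun h => ⟨q, h, rfl⟩, ?_⟩
    rintro ⟨q', h, hq⟩
    cases hq
    exact h
  · change EdgeEnd.LivesIn _ _ ↔ EdgeEnd.LivesIn _ _ ∨ _
    rw [h]
    refine ⟨Or.inl, fun h => h.resolve_right ?_⟩
    rintro ⟨q', -, h⟩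
    cases h

end CutComponent

theorem isClosed_coordTopology_component {C : Set (Sym2 V)} (hCf : C.Finite)
    (hC : ∃ A, cutEdges (G := G) A = C) (v : V) :
    IsClosed[coordTopology G] (withEnds (component G (innerPoints G C)ᶜ (.vertex v))) := by
  rw [withEnds_component_eq hC]
  exact isClosed_coord_preimage (.inl ⟨_, hCf.subset (cutEdges_supp_subset _)⟩) isClosed_Ici

/-- On the attached partial edges the height of the component is bounded below by some `δ > 0`, as
`C` is finite. The set is therefore the closed set where the height is at least `δ`, minus an open
part of each of the finitely many edges of `C`. -/
theorem isClosed_coordTopology_partialEdges {C : Set (Sym2 V)} (hCf : C.Finite)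
    (hC : ∃ A, cutEdges (G := G) A = C) (v : V) (c : G.edgeSet → Ioo (0 : ℝ) 1) :
    IsClosed[coordTopology G] (withEnds (component G (innerPoints G C)ᶜ (.vertex v) ∪
      partialEdges G C (component G (innerPoints G C)ᶜ (.vertex v)) c)) := by
  let := coordTopology G
  set K := (G.deleteEdges C).connectedComponentMk v with hK
  set Q := withEnds (component G (innerPoints G C)ᶜ (.vertex v) ∪
      partialEdges G C (component G (innerPoints G C)ᶜ (.vertex v)) c) with hQ
  have hKf : (cutEdges (G := G) K.supp).Finite := hCf.subset (cutEdges_supp_subset _)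
  obtain ⟨δ, ⟨hδ1, hδ⟩, hδ0⟩ : ∃ δ : ℝ, (δ < 1 ∧ ∀ e : G.edgeSet, e ∈ {e : G.edgeSet | e.1 ∈ C} →
      δ < c e ∧ δ < 1 - c e) ∧ 0 < δ := by
    have : ∀ᶠ δ : ℝ in 𝓝[>] 0, (δ < 1 ∧ ∀ e : G.edgeSet, e ∈ {e : G.edgeSet | e.1 ∈ C} →
        δ < c e ∧ δ < 1 - c e) :=
      (eventually_nhdsWithin_of_eventually_nhds (eventually_lt_nhds one_pos)).and
        ((Filter.eventually_all_finite (finite_edges_in hCf)).2 fun e _ =>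
        (eventually_nhdsWithin_of_eventually_nhds (eventually_lt_nhds (c e).2.1)).and
        (eventually_nhdsWithin_of_eventually_nhds (eventually_lt_nhds (sub_pos.2 (c e).2.2))))
    exact (this.and self_mem_nhdsWithin).exists
  have hpart : ∀ e : G.edgeSet, e.1 ∈ C → ∀ t : Ioo (0 : ℝ) 1, .inl (.inner e t) ∈ Q ↔
      ((toMultigraph G).src e ∈ K.supp ∧ t ≤ c e) ∨
      ((toMultigraph G).tgt e ∈ K.supp ∧ c e ≤ t) := by
    intro e he t
    rw [hQ, withEnds_union_partialEdges]
    constructor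
    · rintro (h | ⟨q, ⟨e', t', -, rfl, h⟩, hq⟩)
      · exact absurd ⟨e, t, he, rfl⟩ (component_subset h)
      · cases hq
        rwa [vertex_mem_component_iff, vertex_mem_component_iff] at h
    · intro h
      rw [← vertex_mem_component_iff, ← vertex_mem_component_iff] at h
      exact Or.inr ⟨_, ⟨e, t, he, rfl, h⟩, rfl⟩
  have hsideQ : {x | 1 ≤ sideFun K.supp x} ⊆ Q := by
    rw [← withEnds_component_eq hC, hQ, withEnds_union_partialEdges]
    exact subset_union_left
  have hQeq : Q = {x | δ ≤ sideFun K.supp x} ∩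
      ⋂ e ∈ {e : G.edgeSet | e.1 ∈ C}, (onEdge e {t | .inl (.inner e t) ∉ Q})ᶜ := by
    apply Subset.antisymm
    · intro x hx
      refine ⟨?_, mem_iInter₂.2 ?_⟩
      · have hx' := hx
        rw [hQ, withEnds_union_partialEdges, withEnds_component_eq hC] at hx'
        rcases hx' with h | ⟨q, ⟨e, t, he, rfl, -⟩, rfl⟩
        · exact hδ1.le.trans h
        · change δ ≤ (toMultigraph G).height K.supp (.inner e t)
          rw [height_inner]
          obtain ⟨h1, h2⟩ := hδ e he
          have := not_both_ends_mem_supp hC K he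
          rcases (hpart e he t).1 hx with ⟨hs, h⟩ | ⟨ht, h⟩
          · have h : (t : ℝ) ≤ c e := h
            rw [indicator_of_mem hs, indicator_of_notMem fun ht => this ⟨hs, ht⟩]
            simp only [Pi.one_apply]
            linarith
          · have h : (c e : ℝ) ≤ t := h
            rw [indicator_of_mem ht, indicator_of_notMem fun hs => this ⟨hs, ht⟩]
            simp only [Pi.one_apply]
            linarith
      · rintro e - ⟨t, ht, rfl⟩
        exact ht hx
    · rintro x ⟨h, hx⟩
      have h : δ ≤ sideFun K.supp x := h
      by_contra hxQ
      have h1 : sideFun K.supp x < 1 := not_le.1 fun h => hxQ (hsideQ h)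
      rcases x with (w | ⟨e, t⟩) | ω
      · by_cases hw : w ∈ K.supp
        · exact h1.ne (indicator_of_mem hw _)
        · exact hδ0.not_ge (h.trans (indicator_of_notMem hw _).le)
      · by_cases he : e.1 ∈ C
        · exact mem_iInter₂.1 hx e he ⟨t, hxQ, rfl⟩
        · have hiff : (toMultigraph G).src e ∈ K.supp ↔ (toMultigraph G).tgt e ∈ K.supp := by
            by_contra h
            exact he (cutEdges_supp_subset K ((mem_cutEdges_iff _ e).2 h))
          simp only [sideFun, height_inner] at h h1
          by_cases hs : (toMultigraph G).src e ∈ K.supp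
          · rw [indicator_of_mem hs, indicator_of_mem (hiff.1 hs)] at h1
            simp at h1
          · rw [indicator_of_notMem hs, indicator_of_notMem (mt hiff.2 hs)] at h
            simp only [mul_zero, add_zero] at h
            exact hδ0.not_ge h
      · by_cases hω : ω.LivesIn K.supp
        · exact h1.ne (if_pos hω)
        · exact hδ0.not_ge (h.trans (if_neg hω).le)
  rw [hQeq]
  refine IsClosed.inter (isClosed_coord_preimage (.inl ⟨_, hKf⟩) isClosed_Ici)
    (isClosed_biInter fun e he => (isOpen_coordTopology_onEdge e ?_).isClosed_compl)
  have : {t | (.inl (.inner e t) : EndSpace G) ∉ Q} =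
      ({t | (toMultigraph G).src e ∈ K.supp ∧ t ≤ c e} ∪
        {t | (toMultigraph G).tgt e ∈ K.supp ∧ c e ≤ t})ᶜ := by
    ext t
    exact not_congr (hpart e he t)
  rw [this]
  exact ((isClosed_const.and isClosed_Iic).union
    (isClosed_const.and isClosed_Ici)).isOpen_compl

theorem coordTopology_le_fctop : coordTopology G ≤ fctop G := by
  refine le_generateFrom ?_
  let := coordTopology G
  rintro O (((⟨e, U, hU, rfl⟩ | ⟨e, a, b, hO⟩) | ⟨C, p, hp, hO⟩) | ⟨C, p, hp, c, hO⟩)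
  · exact isOpen_coordTopology_onEdge e hU
  · exact isClosed_compl_iff.1 (hO ▸ isClosed_coordTopology_onEdge_Icc e a b)
  · obtain ⟨v, hv⟩ := exists_vertex_mem_component hp
    rw [component_eq hv] at hO
    exact isClosed_compl_iff.1 (hO ▸ isClosed_coordTopology_component C.2.1 C.2.2 v)
  · obtain ⟨v, hv⟩ := exists_vertex_mem_component hp
    rw [component_eq hv] at hO
    exact isClosed_compl_iff.1 (hO ▸ isClosed_coordTopology_partialEdges C.2.1 C.2.2 v c)

/-- The complement is the union, over the components of `G` minus the cut that lie outside `A`, of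
basic closed sets with partial edges. Connectedness of `G` makes this union finite. -/
theorem isOpen_fctop_sideFun (hG : G.Connected) {A : Set V}
    (hA : (cutEdges (G := G) A).Finite) {c : ℝ} (hc : c ∈ Ioo (0 : ℝ) 1) :
    IsOpen[fctop G] {x | c < sideFun A x} := by
  classical
  let := fctop G
  let C : FinCut G := ⟨cutEdges A, hA, A, rfl⟩
  -- On a cut edge this is the point of height `c`.
  let x : G.edgeSet → Ioo (0 : ℝ) 1 := fun e =>
    if (toMultigraph G).src e ∈ A then ⟨1 - c, sub_pos.2 hc.2, sub_lt_self _ hc.1⟩ else ⟨c, hc⟩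
  have : Finite (G.deleteEdges C.1).ConnectedComponent :=
    finite_connectedComponent_deleteEdges hG hA
  let D : (G.deleteEdges C.1).ConnectedComponent → Set (Realization V G.edgeSet) := fun K =>
    component G (innerPoints G C.1)ᶜ (.vertex (Quot.out K))
  have hD : ∀ v, .vertex v ∈ D ((G.deleteEdges C.1).connectedComponentMk v) := fun v =>
    vertex_mem_component_iff.2 (Quot.out_eq ((G.deleteEdges C.1).connectedComponentMk v)).symm
  have hDA : ∀ v, Quot.out ((G.deleteEdges C.1).connectedComponentMk v) ∈ A ↔ v ∈ A := fun v =>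
    mem_iff_of_mem_supp (K := (G.deleteEdges C.1).connectedComponentMk v) subset_rfl
      (Quot.out_eq ((G.deleteEdges C.1).connectedComponentMk v)) rfl
  have hvA : ∀ K, Quot.out K ∉ A → ∀ v, .vertex v ∈ D K → v ∉ A := by
    intro K hK v hv hvA
    have := height_eq_of_mem_component (A := A) subset_rfl hv
    simp [Multigraph.height, hK, hvA] at this
  have key : {y | c < sideFun A y}ᶜ =
      ⋃ K ∈ {K : (G.deleteEdges C.1).ConnectedComponent | Quot.out K ∉ A},
      withEnds (D K ∪ partialEdges G C.1 (D K) x) := by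
    simp only [withEnds_union_partialEdges]
    ext y
    simp only [mem_compl_iff, mem_ofPred_eq, not_lt, mem_iUnion, exists_prop]
    constructor
    · intro hy
      rcases y with (v | ⟨e, t⟩) | ω
      · have hv : v ∉ A := fun hv => by
          have : A.indicator (1 : V → ℝ) v ≤ c := hy
          rw [indicator_of_mem hv] at this
          exact this.not_gt hc.2
        exact ⟨_, mt (hDA v).1 hv, Or.inl (hD v)⟩
      · by_cases he : e.1 ∈ C.1
        · simp only [sideFun, height_inner] at hy
          have hst := (mem_cutEdges_iff A e).1 he
          by_cases hs : (toMultigraph G).src e ∈ A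
          · have ht : (toMultigraph G).tgt e ∉ A := by tauto
            refine ⟨_, mt (hDA _).1 ht, Or.inr ⟨_, ⟨e, t, he, rfl, Or.inr ⟨hD _, ?_⟩⟩, rfl⟩⟩
            simp only [x, if_pos hs]
            rw [indicator_of_mem hs, indicator_of_notMem ht] at hy
            simp only [Pi.one_apply] at hy
            exact show 1 - c ≤ t by linarith
          · have ht : (toMultigraph G).tgt e ∈ A := by tauto
            refine ⟨_, mt (hDA _).1 hs, Or.inr ⟨_, ⟨e, t, he, rfl, Or.inl ⟨hD _, ?_⟩⟩, rfl⟩⟩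
            simp only [x, if_neg hs]
            rw [indicator_of_notMem hs, indicator_of_mem ht] at hy
            simp only [Pi.one_apply] at hy
            exact show (t : ℝ) ≤ c by linarith
        · have hst := mt (mem_cutEdges_iff A e).2 he
          have hs : (toMultigraph G).src e ∉ A := fun hs => by
            simp only [sideFun, height_inner] at hy
            rw [indicator_of_mem hs, indicator_of_mem (by tauto)] at hy
            simp only [Pi.one_apply] at hy
            linarith [hc.2]
          exact ⟨_, mt (hDA _).1 hs, Or.inl ((inner_mem_component_iff he t).2 (hD _))⟩
      · have hω : ¬ ω.LivesIn A := fun hω => by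
          simp only [sideFun, if_pos hω] at hy
          exact hy.not_gt hc.2
        obtain ⟨v, hv⟩ := ω.exists_livesIn_component hA
        rw [EdgeEnd.livesIn_iff_mem hA hv subset_rfl] at hω
        refine ⟨_, mt (hDA v).1 hω, Or.inl (hv.mono fun w hw => ?_)⟩
        exact vertex_mem_component_of_reachable subset_rfl
          (SimpleGraph.ConnectedComponent.exact hw).symm (hD v)
    · rintro ⟨K, hK, hy | ⟨_, ⟨e, t, he, rfl, hy⟩, rfl⟩⟩
      · rcases y with q | ω
        · have : (toMultigraph G).height A q = 0 :=
            (height_eq_of_mem_component (A := A) subset_rfl hy).trans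
              (indicator_of_notMem hK _)
          exact this.le.trans hc.1.le
        · have : ω.LivesIn Aᶜ := EdgeEnd.LivesIn.mono hy (hvA K hK)
          rw [EdgeEnd.livesIn_compl_iff hA] at this
          simp only [sideFun, if_neg this]
          exact hc.1.le
      · have hst := (mem_cutEdges_iff A e).1 he
        simp only [sideFun, height_inner]
        rcases hy with ⟨hv, ht⟩ | ⟨hv, ht⟩
        · have hs := hvA K hK _ hv
          simp only [x, if_neg hs] at ht
          have ht : (t : ℝ) ≤ c := ht
          rw [indicator_of_notMem hs, indicator_of_mem (by tauto)]
          simp only [Pi.one_apply]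
          linarith
        · have hs := hvA K hK _ hv
          have hs' : (toMultigraph G).src e ∈ A := by tauto
          simp only [x, if_pos hs'] at ht
          have ht : 1 - c ≤ (t : ℝ) := ht
          rw [indicator_of_notMem hs, indicator_of_mem hs']
          simp only [Pi.one_apply]
          linarith
  rw [← isClosed_compl_iff, key]
  refine (toFinite _).isClosed_biUnion fun K _ => ⟨?_⟩
  refine TopologicalSpace.isOpen_generateFrom_of_mem
    (Or.inr ⟨C, _, vertex_notMem_innerPoints (Quot.out K), x, compl_compl _⟩)

theorem isOpen_fctop_bumpFun (e : G.edgeSet) (s : Ioo (0 : ℝ) 1) {c : ℝ}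
    (hc : c ∈ Ioo (0 : ℝ) 1) :
    IsOpen[fctop G] {x | c < bumpFun e s x} ∧ IsOpen[fctop G] {x | bumpFun e s x < c} := by
  let := fctop G
  -- Off the edge `e` the coordinate is 0, so a condition failing at 0 only concerns points of `e`.
  have hmem : ∀ {x : EndSpace G} {P : ℝ → Prop}, ¬ P 0 →
      (P (bumpFun e s x) ↔ x ∈ onEdge e {t | P (tent s t)}) := by
    intro x P hP
    constructor
    · intro h
      rcases x with (v | ⟨e', t⟩) | ω
      · exact absurd h hP
      · simp only [bumpFun, bump] at h
        split_ifs at h with he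
        · subst he
          exact ⟨t, h, rfl⟩
        · exact absurd h hP
      · exact absurd h hP
    · rintro ⟨t, ht, rfl⟩
      change P (bump (W := V) e s (.inner e t))
      rwa [bump_inner_self]
  constructor
  · have : {x | c < bumpFun e s x} = onEdge e {t | c < tent s t} :=
      ext fun x => hmem (P := fun r => c < r) hc.1.not_gt
    rw [this]
    exact TopologicalSpace.isOpen_generateFrom_of_mem (Or.inl (Or.inl (Or.inl ⟨e, _,
      isOpen_lt continuous_const ((continuous_tent s).comp continuous_subtype_val), rfl⟩)))
  · have ha : c * s ∈ Ioo (0 : ℝ) 1 :=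
      ⟨mul_pos hc.1 s.2.1, mul_lt_one_of_nonneg_of_lt_one_left hc.1.le hc.2 s.2.2.le⟩
    have hb : 1 - c * (1 - s) ∈ Ioo (0 : ℝ) 1 :=
      ⟨sub_pos.2 (mul_lt_one_of_nonneg_of_lt_one_left hc.1.le hc.2
        (sub_le_self _ s.2.1.le)), sub_lt_self _ (mul_pos hc.1 (sub_pos.2 s.2.2))⟩
    refine TopologicalSpace.isOpen_generateFrom_of_mem
      (Or.inl (Or.inl (Or.inr ⟨e, ⟨_, ha⟩, ⟨_, hb⟩, ?_⟩)))
    have : {x | bumpFun e s x < c}ᶜ = onEdge e {t | c ≤ tent s t} := by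
      ext x
      rw [← hmem (P := fun r => c ≤ r) hc.1.not_ge, mem_compl_iff, mem_ofPred_eq, not_lt]
    rw [this]
    congr 1
    ext t
    exact le_tent_iff s.2

theorem fctop_eq_coordTopology (hG : G.Connected) : fctop G = coordTopology G :=
  le_antisymm (le_coordTopology (fun _ hA _ hc => isOpen_fctop_sideFun hG hA hc)
    fun e s _ hc => isOpen_fctop_bumpFun e s hc) coordTopology_le_fctop

theorem sameNhdsSetoid_iff_coord_eq (x y : EndSpace G) :
    (sameNhdsSetoid G).r x y ↔ ∀ j, coord j x = coord j y := by
  let := coordTopology G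
  have h1 : (sameNhdsSetoid G).r x y ↔ Inseparable x y := by
    rw [inseparable_iff_forall_isOpen]
    change (∀ O, IsOpen[etop G] O → _) ↔ _
    rw [etop_eq_coordTopology]
  -- The coordinates induce the topology from a Hausdorff product, where inseparable points are
  -- equal.
  have h2 : IsInducing fun (x : EndSpace G) j => coord j x := by
    refine ⟨?_⟩
    rw [Pi.topologicalSpace, induced_iInf]
    simp only [induced_compose]
    rfl
  rw [h1, ← h2.inseparable_iff, inseparable_iff_eq, funext_iff]

/-! ### Directions are given by vertices or edge-ends -/

/-- Iterate `next`. While the level stays constant `d` strictly drops, so the level must rise again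
and again; a repeated vertex would have the same level and a smaller `d` than itself. -/
theorem exists_ray_of_lex {lev : V → ℕ} {d : ℕ → V → ℕ} {next : V → V} (v₀ : V)
    (hadj : ∀ u, G.Adj u (next u)) (hlev : ∀ u, lev u ≤ lev (next u))
    (hd : ∀ u, lev (next u) = lev u → d (lev u) (next u) < d (lev u) u) :
    ∃ R : Ray G, ∀ n, R.HasTailIn {u | n ≤ lev u} := by
  let r : ℕ → V := fun k => next^[k] v₀
  have hr : ∀ k, r (k + 1) = next (r k) := fun k => Function.iterate_succ_apply' next k v₀
  have hmono : Monotone fun k => lev (r k) := monotone_nat_of_le_succ fun k => by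
    rw [hr]
    exact hlev _
  have hlt : ∀ k j, lev (r (k + (j + 1))) = lev (r k) →
      d (lev (r k)) (r (k + (j + 1))) < d (lev (r k)) (r k) := by
    intro k j
    induction j with
    | zero =>
      intro h
      rw [zero_add, hr] at h ⊢
      exact hd _ h
    | succ j ih =>
      intro h
      have h1 : lev (r (k + (j + 1))) = lev (r k) :=
        le_antisymm (h ▸ hmono (by omega)) (hmono (by omega))
      have h2 := hd (r (k + (j + 1)))
      rw [← hr, h1] at h2
      exact (h2 h).trans (ih h1)
  have hunb : ∀ n, ∃ k, n ≤ lev (r k) := by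
    intro n
    induction n with
    | zero => exact ⟨0, Nat.zero_le _⟩
    | succ n ih =>
      obtain ⟨k, hk⟩ := ih
      induction hm : d n (r k) using Nat.strong_induction_on generalizing k with
      | _ m ihm =>
        subst hm
        rcases hk.lt_or_eq with h | h
        · exact ⟨k, h⟩
        have h1 : n ≤ lev (r (k + 1)) := hk.trans (hmono (Nat.le_succ k))
        rcases h1.lt_or_eq with h' | h'
        · exact ⟨_, h'⟩
        have h2 := hlt k 0
        rw [zero_add, ← h, ← h'] at h2
        exact ihm _ (h2 rfl) (k + 1) h1 rfl
  refine ⟨⟨r, ?_, fun k => hr k ▸ hadj _⟩, fun n => ?_⟩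
  · have key : ∀ i j, i < j → r i ≠ r j := fun i j hij h => ?_
    · intro i j h
      by_contra hne
      exact (lt_or_gt_of_ne hne).elim (fun hij => key i j hij h) fun hij => key j i hij h.symm
    obtain ⟨j, rfl⟩ := Nat.exists_eq_add_of_lt hij
    have := hlt i j
    rw [← add_assoc, ← h] at this
    exact lt_irrefl _ (this rfl)
  · obtain ⟨k, hk⟩ := hunb n
    exact ⟨k, fun k' hk' => hk.trans (hmono hk')⟩

theorem eq_univ_of_cutEdges_eq_empty (hG : G.Connected) {A : Set V} (hA : A.Nonempty)
    (h : cutEdges (G := G) A = ∅) : A = univ := by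
  obtain ⟨w, hw⟩ := hA
  refine eq_univ_of_forall fun u => mem_of_reachable_of_cutEdges_subset h.le (u := w) ?_ hw
  rw [SimpleGraph.deleteEdges_empty]
  exact hG.preconnected w u

/-- A decreasing sequence of components of `G` minus finite sets of edges, with disjoint
boundaries, contains tails of a common ray. -/
theorem exists_ray_of_antitone (hG : G.Connected) (F : ℕ → Set (Sym2 V))
    (K : ∀ n, (G.deleteEdges (F n)).ConnectedComponent) (h0 : (K 0).supp = univ)
    (hK : Antitone fun n => (K n).supp) (hF : ∀ n, ∀ e ∈ F n, ∀ v ∈ e, v ∉ (K (n + 1)).supp)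
    (hv₀ : ∃ v₀, v₀ ∉ (K 1).supp) :
    (∀ u, ∃ n, u ∉ (K n).supp) ∧ ∃ R : Ray G, ∀ n, R.HasTailIn (K n).supp := by
  classical
  obtain ⟨v₀, hv₀⟩ := hv₀
  have hleave : ∀ u, ∃ n, u ∉ (K n).supp := by
    intro u
    obtain ⟨p⟩ := hG.preconnected u v₀
    induction p with
    | nil => exact ⟨1, hv₀⟩
    | @cons u v v₀ h p ih =>
      obtain ⟨n, hn⟩ := ih hv₀
      -- If `u` were still in `K (n + 1)`, the edge `uv` would leave `K n` and so belong to `F n`,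
      -- whose ends avoid `K (n + 1)`.
      refine ⟨n + 1, fun hu => ?_⟩
      exact hF n s(u, v) (cutEdges_supp_subset (K n) ⟨u, hK (Nat.le_succ n) hu, v, hn, h, rfl⟩)
        u (Sym2.mem_mk_left _ _) hu
  refine ⟨hleave, ?_⟩
  let lev : V → ℕ := fun u => Nat.find (hleave u)
  have hlev : ∀ u n, u ∈ (K n).supp ↔ n < lev u := fun u n => by
    rw [Nat.lt_find_iff]
    exact ⟨fun hu m hm => not_not.2 (hK hm hu), fun h => not_not.1 (h n le_rfl)⟩
  have hpos : ∀ u, 0 < lev u := fun u => (hlev u 0).1 (h0 ▸ mem_univ u)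
  choose b hb using fun n => (K n).nonempty_supp
  -- A vertex of level `n` and the target `b n` both lie in `K (n - 1)`, so this distance is
  -- attained by a walk. Levels are positive, so the subtraction is not truncated.
  let d : ℕ → V → ℕ := fun n u => (G.deleteEdges (F (n - 1))).dist u (b n)
  have hnext : ∀ u, ∃ u', G.Adj u u' ∧ lev u ≤ lev u' ∧ d (lev u) u' < d (lev u) u := by
    intro u
    obtain ⟨n, hn⟩ := Nat.exists_eq_succ_of_ne_zero (hpos u).ne'
    have hu : u ∈ (K n).supp := (hlev u n).2 (by omega)
    have hu' : u ∉ (K (n + 1)).supp := fun h => by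
      have := (hlev u (n + 1)).1 h
      omega
    have hbn : b (n + 1) ∈ (K n).supp := hK (Nat.le_succ n) (hb (n + 1))
    have hreach : (G.deleteEdges (F n)).Reachable u (b (n + 1)) :=
      SimpleGraph.ConnectedComponent.exact (Eq.trans hu (Eq.symm hbn))
    obtain ⟨p, hp⟩ := hreach.exists_walk_length_eq_dist
    have hdu : d (lev u) u = p.length := by
      rw [hp, hn]
      rfl
    -- The first edge of a shortest walk stays in the component, so the level does not drop, and it
    -- shortens the distance.
    cases p with
    | nil => exact absurd (hb (n + 1)) hu'
    | @cons _ u' _ h p =>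
      refine ⟨u', (G.deleteEdges_le _) h, ?_, ?_⟩
      · have hu'n : u' ∈ (K n).supp :=
          (SimpleGraph.ConnectedComponent.sound h.reachable).symm.trans hu
        have := (hlev u' n).1 hu'n
        omega
      · rw [hdu, SimpleGraph.Walk.length_cons, hn]
        exact Nat.lt_succ_of_le (SimpleGraph.dist_le p)
  choose next h1 h2 h3 using hnext
  obtain ⟨R, hR⟩ := exists_ray_of_lex v₀ h1 h2 fun u _ => h3 u
  exact ⟨R, fun n => (hR (n + 1)).mono fun u hu => (hlev u n).2 hu⟩

section Direction

variable {ι : Type*} [Preorder ι] [IsDirected ι (· ≤ ·)] {B : ι → Set V}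

/-- There are finitely many components, so one index decides them all; they cannot all be rejected,
since any vertex of that set lies in one of them. -/
theorem exists_component_of_direction [Nonempty ι] (hG : G.Connected) (hB : Antitone B)
    (hne : ∀ i, (B i).Nonempty)
    (hdec : ∀ A : Set V, (cutEdges (G := G) A).Finite → ∃ i, B i ⊆ A ∨ B i ⊆ Aᶜ)
    {F : Set (Sym2 V)} (hF : F.Finite) :
    ∃ K : (G.deleteEdges F).ConnectedComponent, ∃ i, B i ⊆ K.supp := by
  have := finite_connectedComponent_deleteEdges hG hF
  choose i hi using fun K : (G.deleteEdges F).ConnectedComponent =>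
    hdec K.supp (hF.subset (cutEdges_supp_subset K))
  obtain ⟨j, hj⟩ := Finite.exists_le i
  obtain ⟨w, hw⟩ := hne j
  refine ⟨(G.deleteEdges F).connectedComponentMk w, _, (hi _).resolve_right fun h => ?_⟩
  exact h (hB (hj _) hw) rfl

/-- A late member of the family lies in both sets, so they meet, and `K` cannot cross the boundary
of `A`. -/
theorem supp_subset_of_direction (hB : Antitone B) (hne : ∀ i, (B i).Nonempty)
    {F : Set (Sym2 V)} {K : (G.deleteEdges F).ConnectedComponent} (hK : ∃ i, B i ⊆ K.supp)
    {A : Set V} (hA : ∃ i, B i ⊆ A) (hAF : cutEdges (G := G) A ⊆ F) : K.supp ⊆ A := by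
  obtain ⟨i, hi⟩ := hK
  obtain ⟨j, hj⟩ := hA
  obtain ⟨k, hik, hjk⟩ := exists_ge_ge i j
  obtain ⟨w, hw⟩ := hne k
  exact fun u hu => (mem_iff_of_mem_supp hAF (hi (hB hik hw)) hu).1 (hj (hB hjk hw))

/-- A decreasing directed family of nonempty sets of vertices that decides every finite cut
converges to a vertex or to an edge-end. -/
theorem exists_point_of_direction [Nonempty ι] (hG : G.Connected) (hB : Antitone B)
    (hne : ∀ i, (B i).Nonempty)
    (hdec : ∀ A : Set V, (cutEdges (G := G) A).Finite → ∃ i, B i ⊆ A ∨ B i ⊆ Aᶜ) :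
    ∃ x : EndSpace G, ¬ IsInner x ∧
      ∀ A : Set V, (cutEdges (G := G) A).Finite → ∀ i, B i ⊆ A → OnSide A x := by
  by_cases hv : ∃ v, ∀ A : Set V, (cutEdges (G := G) A).Finite → ∀ i, B i ⊆ A → v ∈ A
  · obtain ⟨v, hv⟩ := hv
    exact ⟨.inl (.vertex v), fun h => h, hv⟩
  push Not at hv
  choose A hAf i hi hvA using hv
  obtain ⟨v₀⟩ := hG.nonempty
  -- Now every vertex `v` is excluded by a chosen side `A v`. Adding the cuts of `A v` for all ends
  -- `v` of edges in `F n` pushes these ends out of `K (n + 1)`; `v₀` is included because `F 0` is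
  -- empty.
  let F : ℕ → {F : Set (Sym2 V) // F.Finite} := fun n => Nat.rec ⟨∅, finite_empty⟩
    (fun _ F => ⟨F.1 ∪ ⋃ v ∈ insert v₀ {w | ∃ e ∈ F.1, w ∈ e}, cutEdges (G := G) (A v),
      F.2.union (((finite_setOf_mem_edge F.2).insert v₀).biUnion fun v _ => hAf v)⟩) n
  have hFsucc : ∀ n, (F (n + 1)).1 = (F n).1 ∪
      ⋃ v ∈ insert v₀ {w | ∃ e ∈ (F n).1, w ∈ e}, cutEdges (G := G) (A v) := fun n => rfl
  choose K hK using fun n => exists_component_of_direction hG hB hne hdec (F n).2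
  have hsub : ∀ n, ∀ v ∈ insert v₀ {w | ∃ e ∈ (F n).1, w ∈ e}, v ∉ (K (n + 1)).supp := by
    intro n v hv hvK
    refine hvA v (supp_subset_of_direction hB hne (hK (n + 1)) ⟨_, hi v⟩ ?_ hvK)
    rw [hFsucc]
    exact (subset_biUnion_of_mem (u := fun v => cutEdges (G := G) (A v)) hv).trans
      subset_union_right
  have hanti : Antitone fun n => (K n).supp := antitone_nat_of_succ_le fun n =>
    supp_subset_of_direction hB hne (hK (n + 1)) (hK n)
      ((cutEdges_supp_subset (K n)).trans (hFsucc n ▸ subset_union_left))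
  have h0 : (K 0).supp = univ := eq_univ_of_cutEdges_eq_empty hG (K 0).nonempty_supp
    (subset_empty_iff.1 (cutEdges_supp_subset (K 0)))
  obtain ⟨hleave, R, hR⟩ := exists_ray_of_antitone hG (fun n => (F n).1) K h0 hanti
    (fun n e he v hv => hsub n v (Or.inr ⟨e, he, hv⟩)) ⟨v₀, hsub 0 v₀ (Or.inl rfl)⟩
  refine ⟨.inr (Quotient.mk _ R), fun h => h, fun A' hA' i' hi' => ⟨R, rfl, ?_⟩⟩
  choose lev hlev using hleave
  -- The finitely many ends of the cut of `A'` have all left some `K n`. Then `A' ∩ K n` has its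
  -- boundary in `F n`, which forces `K n` into `A'`.
  obtain ⟨n, hn⟩ : ∃ n, ∀ w ∈ {w | ∃ e ∈ cutEdges (G := G) A', w ∈ e}, w ∉ (K n).supp := by
    obtain ⟨n, hn⟩ := ((finite_setOf_mem_edge hA').image lev).bddAbove
    exact ⟨n, fun w hw h => hlev w (hanti (hn (mem_image_of_mem _ hw)) h)⟩
  refine (hR n).mono fun u hu => ?_
  have hcut : cutEdges (G := G) (A' ∩ (K n).supp) ⊆ (F n).1 := by
    rintro _ ⟨a, ⟨ha, haK⟩, b, hb, hab, rfl⟩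
    by_cases hbA : b ∈ A'
    · exact cutEdges_supp_subset (K n) ⟨a, haK, b, fun h => hb ⟨hbA, h⟩, hab, rfl⟩
    · exact absurd haK (hn a ⟨_, ⟨a, ha, b, hbA, hab, rfl⟩, Sym2.mem_mk_left _ _⟩)
  obtain ⟨j, hj⟩ := hK n
  obtain ⟨k, hik, hjk⟩ := exists_ge_ge i' j
  exact (supp_subset_of_direction hB hne (hK n)
    ⟨k, subset_inter ((hB hik).trans hi') ((hB hjk).trans hj)⟩ hcut hu).1

end Direction

/-! ### Uniqueness of the sides of a cut, and directions in coordinates. -/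

theorem mk_mem_cutEdges_iff {a b : V} (h : G.Adj a b) (A : Set V) :
    s(a, b) ∈ cutEdges (G := G) A ↔ ¬ (a ∈ A ↔ b ∈ A) := by
  obtain ⟨e, he, ⟨rfl, rfl⟩ | ⟨rfl, rfl⟩⟩ := exists_edge_of_adj h
  · rw [← he, mem_cutEdges_iff]
  · rw [← he, mem_cutEdges_iff, not_iff_not]
    exact iff_comm

/-- Along each edge, membership in `A` and in `B` changes for both or for neither. So the set where
they agree and the set where they differ have empty boundary, and whichever contains `v₀` is
everything. -/
theorem eq_or_eq_compl_of_cutEdges_eq (hG : G.Connected) {A B : Set V}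
    (h : cutEdges (G := G) A = cutEdges (G := G) B) : A = B ∨ A = Bᶜ := by
  obtain ⟨v₀⟩ := hG.nonempty
  have hcut : ∀ D : Set V, (∀ a b, (a ∈ A ↔ b ∈ A) → (a ∈ B ↔ b ∈ B) → a ∈ D → b ∈ D) →
      (∀ a b, ¬ (a ∈ A ↔ b ∈ A) → ¬ (a ∈ B ↔ b ∈ B) → a ∈ D → b ∈ D) →
      cutEdges (G := G) D = ∅ := by
    intro D h1 h2
    refine eq_empty_of_forall_notMem ?_
    rintro _ ⟨a, ha, b, hb, hab, rfl⟩
    have hA := mk_mem_cutEdges_iff hab A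
    have hB := mk_mem_cutEdges_iff hab B
    rw [h] at hA
    by_cases hs : s(a, b) ∈ cutEdges (G := G) B
    · exact hb (h2 a b (hA.1 hs) (hB.1 hs) ha)
    · exact hb (h1 a b (not_not.1 (mt hA.2 hs)) (not_not.1 (mt hB.2 hs)) ha)
  by_cases h0 : v₀ ∈ A ↔ v₀ ∈ B
  · left
    have := eq_univ_of_cutEdges_eq_empty hG (A := {u | u ∈ A ↔ u ∈ B}) ⟨v₀, h0⟩
      (hcut _ (fun a b h1 h2 h3 => h1.symm.trans (h3.trans h2)) fun a b h1 h2 h3 => by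
        simp only [mem_ofPred_eq] at h3 ⊢
        tauto)
    exact ext fun u => this.ge (mem_univ u)
  · right
    have := eq_univ_of_cutEdges_eq_empty hG (A := {u | u ∈ A ↔ u ∉ B}) ⟨v₀, by
        simp only [mem_ofPred_eq]; tauto⟩
      (hcut _ (fun a b h1 h2 h3 => h1.symm.trans (h3.trans (not_congr h2))) fun a b h1 h2 h3 => by
        simp only [mem_ofPred_eq] at h3 ⊢
        tauto)
    exact ext fun u => this.ge (mem_univ u)

theorem eq_or_vertex_of_bump_eq {W E : Type*} {x y : Realization W E}
    (h : ∀ e s, bump e s x = bump e s y) :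
    x = y ∨ ∃ w w', x = .vertex w ∧ y = .vertex w' := by
  rcases x with w | ⟨e, t⟩
  · rcases y with w' | ⟨e, t⟩
    · exact Or.inr ⟨w, w', rfl, rfl⟩
    · exact Or.inl (eq_of_bump_eq_one ((h e t).trans
        ((bump_inner_self e t t).trans (tent_self t.2))))
  · exact Or.inl (eq_of_bump_eq_one ((h e t).symm.trans
      ((bump_inner_self e t t).trans (tent_self t.2)))).symm

theorem onSide_compl_iff {A : Set V} (hA : (cutEdges (G := G) A).Finite) {x : EndSpace G}
    (hx : ¬ IsInner x) : OnSide Aᶜ x ↔ ¬ OnSide A x := by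
  rcases x with (v | ⟨e, t⟩) | ω
  · exact Iff.rfl
  · exact absurd trivial hx
  · exact EdgeEnd.livesIn_compl_iff hA

/-- This is how contracting an edge looks to the coordinates that do not involve it. -/
theorem coord_inner_of_notMem {j : Coord G} {e : G.edgeSet}
    (h1 : ∀ A, j = .inl A → e.1 ∉ cutEdges (G := G) A.1) (h2 : ∀ s, j ≠ .inr (e, s))
    (t : Ioo (0 : ℝ) 1) :
    coord j (.inl (.inner e t)) = coord j (.inl (.vertex ((toMultigraph G).src e))) := by
  rcases j with A | ⟨e', s⟩
  · have := mt (mem_cutEdges_iff A.1 e).2 (h1 A rfl)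
    rw [not_not] at this
    change (1 - (t : ℝ)) * _ + t * _ = A.1.indicator 1 _
    by_cases hs : (toMultigraph G).src e ∈ A.1
    · rw [indicator_of_mem hs, indicator_of_mem (this.1 hs)]
      simp
    · rw [indicator_of_notMem hs, indicator_of_notMem (mt this.2 hs)]
      simp
  · exact if_neg fun h : e = e' => h2 s (by rw [h])

theorem exists_direction_point {ι : Type*} [Preorder ι] [IsDirected ι (· ≤ ·)] [Nonempty ι]
    (hG : G.Connected) {B : ι → Set V} (hB : Antitone B) (hne : ∀ i, (B i).Nonempty)
    (S : ι → Set (Coord G)) (hcover : ∀ j, ∃ i, j ∈ S i)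
    (hdec : ∀ i A, .inl A ∈ S i → B i ⊆ A.1 ∨ B i ⊆ A.1ᶜ) :
    ∃ x : EndSpace G, (∀ e s, bumpFun e s x = 0) ∧
      ∀ i A, .inl A ∈ S i → ∀ v ∈ B i, sideFun A.1 x = A.1.indicator 1 v := by
  obtain ⟨x, hx, h⟩ := exists_point_of_direction hG hB hne fun A hA =>
    (hcover (.inl ⟨A, hA⟩)).imp fun i hi => hdec i _ hi
  refine ⟨x, fun e s => bumpFun_of_not_isInner e s hx, fun i A hA v hv => ?_⟩
  rw [sideFun_of_not_isInner _ hx]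
  rcases hdec i A hA with h' | h'
  · rw [indicator_of_mem (h' hv), if_pos (h _ A.2 i h')]
    rfl
  · rw [indicator_of_notMem (h' hv), if_neg]
    exact (onSide_compl_iff A.2 hx).1 (h _ (by rw [cutEdges_compl]; exact A.2) i h')

/-! ### The inverse system of the multigraphs `G_M` -/

theorem side_eq_side (C : FinCut G) {v w : V}
    (h : ∀ A, cutEdges (G := G) A = C.1 → (v ∈ A ↔ w ∈ A)) :
    C.side v = C.side w := by
  have := h _ C.2.2.choose_spec
  by_cases hw : w ∈ C.2.2.choose
  · rw [FinCut.side, FinCut.side, if_pos hw, if_pos (this.2 hw)]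
  · rw [FinCut.side, FinCut.side, if_neg hw, if_neg (mt this.1 hw)]

theorem finite_word (hG : G.Connected) (M : Finset (FinCut G)) : Finite (Word G M) := by
  have : ∀ X : Word G M, ∀ C : M,
      X.1 C ∈ ({C.1.2.2.choose, C.1.2.2.chooseᶜ} : Set (Set V)) := fun X C =>
    eq_or_eq_compl_of_cutEdges_eq hG ((X.2.1 C).trans C.1.2.2.choose_spec.symm)
  refine Finite.of_injective (fun (X : Word G M) (C : M) =>
    (⟨X.1 C, this X C⟩ : ({C.1.2.2.choose, C.1.2.2.chooseᶜ} : Set (Set V)))) ?_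
  intro X Y h
  exact Subtype.ext (funext fun C => congrArg Subtype.val (congrFun h C))

/-- An edge in none of the cuts of `M` has both ends in the same word, so it is a loop. -/
theorem finite_nonloops_cutGraph (M : Finset (FinCut G)) :
    {e | (cutGraph G M).src e ≠ (cutGraph G M).tgt e}.Finite := by
  refine ((M.finite_toSet.biUnion fun C _ => finite_edges_in (G := G) C.2.1)).subset fun e he => ?_
  by_contra h
  refine he (Subtype.ext (funext fun C => side_eq_side C.1 fun A hA => ?_))
  have heC : e.1 ∉ cutEdges (G := G) A := fun heC =>
    h (mem_iUnion₂.2 ⟨C.1, C.2, show e.1 ∈ C.1.1 from hA ▸ heC⟩)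
  rw [mem_cutEdges_iff, not_not] at heC
  exact heC

theorem compactSpace_cutGraphSpace (hG : G.Connected) (M : Finset (FinCut G)) :
    CompactSpace (CutGraphSpace G M) :=
  have := finite_word hG M
  (cutGraph G M).compactSpace_earringComplexTopology (finite_nonloops_cutGraph M)

/-- The coordinates that are defined on `‖G_M‖`. -/
def cutCoords (M : Finset (FinCut G)) : Set (Coord G) :=
  {j | ∀ A, j = .inl A → (⟨cutEdges A.1, A.2, A.1, rfl⟩ : FinCut G) ∈ M}

/-- The coordinate functions on `‖G_M‖`. -/
def cutGraphCoord (M : Finset (FinCut G)) : Coord G → CutGraphSpace G M → ℝ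
  | .inl A, p => (cutGraph G M).height {X | ⋂ C, X.1 C ⊆ A.1} p
  | .inr x, p => bump x.1 x.2 p

theorem word_subset_or (hG : G.Connected) {M : Finset (FinCut G)}
    {A : {A : Set V // (cutEdges (G := G) A).Finite}} (hA : .inl A ∈ cutCoords M) (X : Word G M) :
    ⋂ C, X.1 C ⊆ A.1 ∨ ⋂ C, X.1 C ⊆ A.1ᶜ := by
  have := eq_or_eq_compl_of_cutEdges_eq hG (X.2.1 ⟨_, hA A rfl⟩)
  rcases this with h | h
  · exact Or.inl ((iInter_subset _ _).trans h.le)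
  · exact Or.inr ((iInter_subset _ _).trans h.le)

theorem cutGraphCoord_vertex (hG : G.Connected) {M : Finset (FinCut G)}
    {A : {A : Set V // (cutEdges (G := G) A).Finite}} (hA : .inl A ∈ cutCoords M) {X : Word G M}
    {v : V} (hv : v ∈ ⋂ C, X.1 C) :
    {X : Word G M | ⋂ C, X.1 C ⊆ A.1}.indicator (1 : Word G M → ℝ) X = A.1.indicator 1 v := by
  rcases word_subset_or hG hA X with h | h
  · rw [indicator_of_mem (h hv), indicator_of_mem (by exact h)]
    rfl
  · rw [indicator_of_notMem (h hv),
      indicator_of_notMem fun h' : ⋂ C, X.1 C ⊆ A.1 => h hv (h' hv)]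

theorem mem_wordOf (M : Finset (FinCut G)) (v : V) : v ∈ ⋂ C, (wordOf G M v).1 C :=
  mem_iInter.2 fun C => C.1.mem_side v

theorem cutGraphCoord_wordOf (hG : G.Connected) {M : Finset (FinCut G)} {j : Coord G}
    (hj : j ∈ cutCoords M) (v : V) :
    cutGraphCoord M j (.vertex (wordOf G M v)) = coord j (.inl (.vertex v)) := by
  rcases j with A | x
  · exact cutGraphCoord_vertex hG hj (mem_wordOf M v)
  · rfl

theorem cutGraphCoord_inner (hG : G.Connected) {M : Finset (FinCut G)} {j : Coord G}
    (hj : j ∈ cutCoords M) (e : G.edgeSet) (t : Ioo (0 : ℝ) 1) :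
    cutGraphCoord M j (.inner e t) = coord j (.inl (.inner e t)) := by
  rcases j with A | x
  · exact congrArg₂ (fun a b => (1 - (t : ℝ)) * a + t * b)
      (cutGraphCoord_vertex hG hj (mem_wordOf M _)) (cutGraphCoord_vertex hG hj (mem_wordOf M _))
  · rfl

theorem cutGraph_inverseSystem (hG : G.Connected) :
    IsInverseSystem (cutGraphMap G) ∧ T2Space (inverseLimit (cutGraphMap G)) ∧
      ∃ Φ : EndSpace G → inverseLimit (cutGraphMap G), Function.Surjective Φ ∧
        TopologicalSpace.induced Φ inferInstance = coordTopology G ∧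
        ∀ y y', Φ y = Φ y' ↔ ∀ j, coord j y = coord j y' := by
  classical
  have := compactSpace_cutGraphSpace hG
  have hmono : Monotone (cutCoords (G := G)) := fun M M' h j hj A hA => h (hj A hA)
  have hcover : ∀ j : Coord G, ∃ M, j ∈ cutCoords M := by
    rintro (A | x)
    · refine ⟨{⟨cutEdges A.1, A.2, A.1, rfl⟩}, fun A' h => ?_⟩
      cases h
      exact Finset.mem_singleton_self _
    · exact ⟨∅, fun A' h => by cases h⟩
  have hinr : ∀ (M : Finset (FinCut G)) x, .inr x ∈ cutCoords M := fun M x A h => by cases h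
  have hmap : ∀ M M' (hi : M ≤ M') (x : CutGraphSpace G M'), ∀ j ∈ cutCoords M,
      cutGraphCoord M j (cutGraphMap G M M' hi x) = cutGraphCoord M' j x := by
    rintro M M' h (X | ⟨e, t⟩) j hj
    · rcases j with A | x
      · obtain ⟨v, hv⟩ := X.2.2
        exact (cutGraphCoord_vertex hG hj
          (mem_iInter.2 fun C => mem_iInter.1 hv ⟨C.1, h C.2⟩)).trans
          (cutGraphCoord_vertex hG (hmono h hj) hv).symm
      · rfl
    · exact (cutGraphCoord_inner hG hj e t).trans (cutGraphCoord_inner hG (hmono h hj) e t).symm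
  refine inverseSystem_of_coordinates (cutGraphMap G) cutCoords cutGraphCoord coord ?_ ?_ hmono
    hmap hcover ?_ ?_
  · rintro M (A | x) -
    · exact (cutGraph G M).continuous_height_earring _
    · exact (cutGraph G M).continuous_bump_earring x.1 x.2
  · intro M x y h
    rcases eq_or_vertex_of_bump_eq fun e s => h (.inr (e, s)) (hinr M _) with
      h' | ⟨X, Y, rfl, rfl⟩
    · exact h'
    -- The letter of `X` at `C` is itself a side of a cut in `M`, and its coordinate detects whether
    -- `Y` has the same letter.
    · refine congrArg Realization.vertex (Subtype.ext (funext fun C => ?_))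
      have hA : (cutEdges (G := G) (X.1 C)).Finite := by
        rw [X.2.1 C]
        exact C.1.2.1
      have hmem : .inl ⟨X.1 C, hA⟩ ∈ cutCoords M := fun A h => by
        cases h
        have : (⟨cutEdges (G := G) (X.1 C), hA, X.1 C, rfl⟩ : FinCut G) = C.1 :=
          Subtype.ext (X.2.1 C)
        rw [this]
        exact C.2
      obtain ⟨v, hv⟩ := X.2.2
      obtain ⟨w, hw⟩ := Y.2.2
      have h1 := (cutGraphCoord_vertex hG hmem hv).symm.trans
        ((h _ hmem).trans (cutGraphCoord_vertex hG hmem hw))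
      have hwX : w ∈ X.1 C := by
        by_contra hwX
        simp [indicator_of_mem (mem_iInter.1 hv C), indicator_of_notMem hwX] at h1
      rcases eq_or_eq_compl_of_cutEdges_eq hG ((X.2.1 C).trans (Y.2.1 C).symm) with h2 | h2
      · exact h2
      · rw [h2] at hwX
        exact absurd (mem_iInter.1 hw C) hwX
  · rintro M ((v | ⟨e, t⟩) | ω)
    · exact ⟨_, fun j hj => cutGraphCoord_wordOf hG hj v⟩
    · exact ⟨_, fun j hj => cutGraphCoord_inner hG hj e t⟩
    -- An edge-end goes to the word of a vertex in its component of `G` minus all edges of cuts in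
    -- `M`.
    · have hF : (⋃ C ∈ M, C.1).Finite := M.finite_toSet.biUnion fun C _ => C.2.1
      obtain ⟨v, hv⟩ := ω.exists_livesIn_component hF
      refine ⟨_, fun j hj => (cutGraphCoord_wordOf hG hj v).trans ?_⟩
      rcases j with A | x
      · have := EdgeEnd.livesIn_iff_mem hF hv (A := A.1)
          (subset_biUnion_of_mem (u := fun C : FinCut G => C.1) (hj A rfl))
        by_cases hvA : v ∈ A.1
        · exact (indicator_of_mem hvA _).trans (if_pos (this.2 hvA)).symm
        · exact (indicator_of_notMem hvA _).trans (if_neg (mt this.1 hvA)).symm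
      · rfl
  · intro x hx
    by_cases hin : ∃ M e t, x M = .inner e t
    · obtain ⟨M₀, e, t, h₀⟩ := hin
      refine ⟨.inl (.inner e t), fun M j hj => ?_⟩
      have h1 := hx M₀ (M ∪ M₀) Finset.subset_union_right
      have h2 := hx M (M ∪ M₀) Finset.subset_union_left
      rw [← h2, hmap _ _ _ _ _ hj]
      -- Bonding maps send vertices to vertices, so the thread shows the same inner point at the
      -- common refinement.
      have h3 : x (M ∪ M₀) = .inner e t := by
        rw [h₀] at h1
        rcases hM : x (M ∪ M₀) with X | ⟨e', t'⟩
        · rw [hM] at h1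
          cases h1
        · rw [hM] at h1
          obtain ⟨rfl, rfl⟩ := Realization.inner.inj h1
          rfl
      rw [h3]
      exact cutGraphCoord_inner hG (hmono Finset.subset_union_left hj) e t
    · have hv : ∀ M, ∃ X : Word G M, x M = .vertex X := by
        intro M
        rcases hM : x M with X | ⟨e, t⟩
        · exact ⟨X, rfl⟩
        · exact absurd ⟨M, e, t, hM⟩ hin
      choose X hX using hv
      -- A thread of words gives a decreasing directed family of nonempty vertex sets that decides
      -- every finite cut.
      have hanti : Antitone fun M => ⋂ C, (X M).1 C := by
        intro M M' h v hv
        have h1 := hx M M' h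
        rw [hX, hX] at h1
        have h2 := Realization.vertex.inj h1
        change v ∈ ⋂ C, (X M).1 C
        rw [← h2]
        exact mem_iInter.2 fun C => mem_iInter.1 hv ⟨C.1, h C.2⟩
      obtain ⟨y, hy1, hy2⟩ := exists_direction_point hG hanti (fun M => (X M).2.2) cutCoords hcover
        fun M A hA => word_subset_or hG hA (X M)
      refine ⟨y, fun M j hj => ?_⟩
      rw [hX]
      rcases j with A | ⟨e, s⟩
      · obtain ⟨v, hv⟩ := (X M).2.2
        exact (cutGraphCoord_vertex hG hj hv).trans (hy2 M A hj v hv).symm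
      · exact (hy1 e s).symm

/-! ### The inverse system of the finite multigraphs `G.E` -/

theorem finite_components (hG : G.Connected) (E : Finset G.edgeSet) :
    Finite (deleteFin G E).ConnectedComponent :=
  finite_connectedComponent_deleteEdges hG (E.finite_toSet.image _)

theorem compactSpace_edgeGraphSpace (hG : G.Connected) (E : Finset G.edgeSet) :
    CompactSpace (EdgeGraphSpace G E) :=
  have := finite_components hG E
  (edgeGraph G E).compactSpace_complexTopology

theorem edgeGraphMap_inner_of_mem {E E' : Finset G.edgeSet} (h : E ≤ E') {e : E'} (he : e.1 ∈ E)
    (t : Ioo (0 : ℝ) 1) : edgeGraphMap G E E' h (.inner e t) = .inner ⟨e.1, he⟩ t := dif_pos he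

theorem edgeGraphMap_inner_of_notMem {E E' : Finset G.edgeSet} (h : E ≤ E') {e : E'}
    (he : e.1 ∉ E) (t : Ioo (0 : ℝ) 1) : edgeGraphMap G E E' h (.inner e t) =
      .vertex ((deleteFin G E).connectedComponentMk ((toMultigraph G).src e.1)) := dif_neg he

/-- The coordinates that are defined on `‖G.E‖`. -/
def edgeCoords (E : Finset G.edgeSet) : Set (Coord G) :=
  {j | (∀ A, j = .inl A → cutEdges (G := G) A.1 ⊆ Subtype.val '' (E : Set G.edgeSet)) ∧
    ∀ e s, j = .inr (e, s) → e ∈ E}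

open Classical in
/-- The coordinate functions on `‖G.E‖`. -/
def edgeGraphCoord (E : Finset G.edgeSet) : Coord G → EdgeGraphSpace G E → ℝ
  | .inl A, p => (edgeGraph G E).height {K | K.supp ⊆ A.1} p
  | .inr x, p => if he : x.1 ∈ E then bump ⟨x.1, he⟩ x.2 p else 0

theorem supp_subset_or {E : Finset G.edgeSet} {A : {A : Set V // (cutEdges (G := G) A).Finite}}
    (hA : .inl A ∈ edgeCoords E) (K : (deleteFin G E).ConnectedComponent) :
    K.supp ⊆ A.1 ∨ K.supp ⊆ A.1ᶜ := by
  obtain ⟨v, hv⟩ := K.nonempty_supp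
  by_cases hvA : v ∈ A.1
  · exact Or.inl fun u hu => (mem_iff_of_mem_supp (hA.1 A rfl) hv hu).1 hvA
  · exact Or.inr fun u hu huA => hvA ((mem_iff_of_mem_supp (hA.1 A rfl) hv hu).2 huA)

theorem edgeGraphCoord_vertex {E : Finset G.edgeSet}
    {A : {A : Set V // (cutEdges (G := G) A).Finite}} (hA : .inl A ∈ edgeCoords E)
    {K : (deleteFin G E).ConnectedComponent} {v : V} (hv : v ∈ K.supp) :
    {K : (deleteFin G E).ConnectedComponent | K.supp ⊆ A.1}.indicator
      (1 : (deleteFin G E).ConnectedComponent → ℝ) K = A.1.indicator 1 v := by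
  rcases supp_subset_or hA K with h | h
  · rw [indicator_of_mem (h hv), indicator_of_mem (by exact h)]
    rfl
  · rw [indicator_of_notMem (h hv),
      indicator_of_notMem fun h' : K.supp ⊆ A.1 => h hv (h' hv)]

theorem edgeGraphCoord_inr_vertex {E : Finset G.edgeSet} (x : G.edgeSet × Ioo (0 : ℝ) 1)
    (K : (deleteFin G E).ConnectedComponent) : edgeGraphCoord E (.inr x) (.vertex K) = 0 := by
  simp only [edgeGraphCoord]
  split_ifs <;> rfl

theorem edgeGraphCoord_mk {E : Finset G.edgeSet} {j : Coord G} (hj : j ∈ edgeCoords E) (v : V) :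
    edgeGraphCoord E j (.vertex ((deleteFin G E).connectedComponentMk v)) =
      coord j (.inl (.vertex v)) := by
  rcases j with A | x
  · exact edgeGraphCoord_vertex hj rfl
  · exact edgeGraphCoord_inr_vertex x _

theorem edgeGraphCoord_inner {E : Finset G.edgeSet} {j : Coord G} (hj : j ∈ edgeCoords E) (e : E)
    (t : Ioo (0 : ℝ) 1) :
    edgeGraphCoord E j (.inner e t) = coord j (.inl (.inner e.1 t)) := by
  rcases j with A | ⟨e', s⟩
  · exact congrArg₂ (fun a b => (1 - (t : ℝ)) * a + t * b)
      (edgeGraphCoord_vertex hj rfl) (edgeGraphCoord_vertex hj rfl)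
  · have he : e' ∈ E := hj.2 e' s rfl
    simp only [edgeGraphCoord, dif_pos he, coord, bumpFun, bump]
    by_cases h : e.1 = e'
    · rw [if_pos h, if_pos (Subtype.ext h)]
    · rw [if_neg h, if_neg fun h' => h (congrArg _ h')]

theorem coord_inner_of_mem_edgeCoords {E : Finset G.edgeSet} {j : Coord G}
    (hj : j ∈ edgeCoords E) {e : G.edgeSet} (he : e ∉ E) (t : Ioo (0 : ℝ) 1) :
    coord j (.inl (.inner e t)) = coord j (.inl (.vertex ((toMultigraph G).src e))) := by
  refine coord_inner_of_notMem (fun A hA heA => ?_) (fun s hs => he (hj.2 e s hs)) t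
  obtain ⟨e', he', h⟩ := hj.1 A hA heA
  exact he (Subtype.ext h ▸ he')

theorem edgeGraph_inverseSystem (hG : G.Connected) :
    IsInverseSystem (edgeGraphMap G) ∧ T2Space (inverseLimit (edgeGraphMap G)) ∧
      ∃ Φ : EndSpace G → inverseLimit (edgeGraphMap G), Function.Surjective Φ ∧
        TopologicalSpace.induced Φ inferInstance = coordTopology G ∧
        ∀ y y', Φ y = Φ y' ↔ ∀ j, coord j y = coord j y' := by
  classical
  have := compactSpace_edgeGraphSpace hG
  have hmono : Monotone (edgeCoords (G := G)) := fun E E' h j hj =>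
    ⟨fun A hA => (hj.1 A hA).trans (image_mono (Finset.coe_subset.2 h)),
      fun e s he => h (hj.2 e s he)⟩
  have hcover : ∀ j : Coord G, ∃ E, j ∈ edgeCoords E := by
    rintro (A | ⟨e, s⟩)
    · refine ⟨(finite_edges_in A.2).toFinset, fun A' h => ?_, fun e s h => (by cases h)⟩
      cases h
      rintro _ ⟨a, ha, b, hb, hab, rfl⟩
      refine ⟨⟨s(a, b), hab⟩, ?_, rfl⟩
      rw [Finite.coe_toFinset]
      exact ⟨a, ha, b, hb, hab, rfl⟩
    · refine ⟨{e}, fun A' h => (by cases h), fun e s h => ?_⟩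
      cases h
      exact Finset.mem_singleton_self _
  have hmap : ∀ E E' (hi : E ≤ E') (x : EdgeGraphSpace G E'), ∀ j ∈ edgeCoords E,
      edgeGraphCoord E j (edgeGraphMap G E E' hi x) = edgeGraphCoord E' j x := by
    rintro E E' h (K | ⟨e, t⟩) j hj
    · obtain ⟨v, rfl⟩ := K.exists_rep
      exact (edgeGraphCoord_mk hj v).trans (edgeGraphCoord_mk (hmono h hj) v).symm
    · rw [edgeGraphCoord_inner (hmono h hj)]
      by_cases he : e.1 ∈ E
      · rw [edgeGraphMap_inner_of_mem h he]
        exact edgeGraphCoord_inner hj _ t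
      · rw [edgeGraphMap_inner_of_notMem h he]
        exact (edgeGraphCoord_mk hj _).trans (coord_inner_of_mem_edgeCoords hj he t).symm
  refine inverseSystem_of_coordinates (edgeGraphMap G) edgeCoords edgeGraphCoord coord ?_ ?_ hmono
    hmap hcover ?_ ?_
  · rintro E (A | ⟨e, s⟩) hj
    · exact (edgeGraph G E).continuous_height _
    · have he : e ∈ E := hj.2 e s rfl
      have : edgeGraphCoord E (.inr (e, s)) = bump ⟨e, he⟩ s := funext fun p => dif_pos he
      rw [this]
      exact (edgeGraph G E).continuous_bump ⟨e, he⟩ s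
  · intro E x y h
    have hb : ∀ e s, bump e s x = bump e s y := by
      rintro ⟨e, he⟩ s
      have := h (.inr (e, s)) ⟨fun A h => (by cases h), fun e' s' h => (by cases h; exact he)⟩
      simpa only [edgeGraphCoord, dif_pos he] using this
    rcases eq_or_vertex_of_bump_eq hb with h' | ⟨K, K', rfl, rfl⟩
    · exact h'
    -- The component `K` is itself a side of a finite cut inside `E`, and its coordinate separates
    -- it from the others.
    · have hsub : cutEdges (G := G) K.supp ⊆ Subtype.val '' (E : Set G.edgeSet) :=
        cutEdges_supp_subset K
      have hmem : .inl ⟨K.supp, (E.finite_toSet.image _).subset hsub⟩ ∈ edgeCoords E :=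
        ⟨fun A h => (by cases h; exact hsub), fun e s h => (by cases h)⟩
      obtain ⟨v, hv⟩ := K.nonempty_supp
      obtain ⟨w, hw⟩ := K'.nonempty_supp
      have h1 := (edgeGraphCoord_vertex hmem hv).symm.trans
        ((h _ hmem).trans (edgeGraphCoord_vertex hmem hw))
      have hwK : w ∈ K.supp := by
        by_contra hwK
        simp only [indicator_of_mem hv, indicator_of_notMem hwK, Pi.one_apply,
          one_ne_zero] at h1
      exact congrArg Realization.vertex (Eq.trans (Eq.symm hwK) hw)
  · rintro E ((v | ⟨e, t⟩) | ω)
    · exact ⟨_, fun j hj => edgeGraphCoord_mk hj v⟩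
    · by_cases he : e ∈ E
      · exact ⟨_, fun j hj => edgeGraphCoord_inner hj ⟨e, he⟩ t⟩
      · exact ⟨_, fun j hj => (edgeGraphCoord_mk hj _).trans
          (coord_inner_of_mem_edgeCoords hj he t).symm⟩
    · have hF := E.finite_toSet.image Subtype.val
      obtain ⟨v, hv⟩ := ω.exists_livesIn_component hF
      refine ⟨_, fun j hj => (edgeGraphCoord_mk hj v).trans ?_⟩
      rcases j with A | x
      · have := EdgeEnd.livesIn_iff_mem hF hv (hj.1 A rfl)
        by_cases hvA : v ∈ A.1
        · exact (indicator_of_mem hvA _).trans (if_pos (this.2 hvA)).symm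
        · exact (indicator_of_notMem hvA _).trans (if_neg (mt this.1 hvA)).symm
      · rfl
  · intro x hx
    by_cases hin : ∃ E e t, x E = .inner e t
    · obtain ⟨E₀, e, t, h₀⟩ := hin
      refine ⟨.inl (.inner e.1 t), fun E j hj => ?_⟩
      have h1 := hx E₀ (E ∪ E₀) Finset.subset_union_right
      have h2 := hx E (E ∪ E₀) Finset.subset_union_left
      rw [← h2, hmap _ _ _ _ _ hj]
      -- Vertices and contracted edges map to vertices, so only the same point of the same edge can
      -- lie over the given inner point.
      obtain ⟨e', he', h3⟩ : ∃ e' : (E ∪ E₀ : Finset G.edgeSet), e'.1 = e.1 ∧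
          x (E ∪ E₀) = .inner e' t := by
        rw [h₀] at h1
        rcases hE : x (E ∪ E₀) with K | ⟨e', t'⟩
        · rw [hE] at h1
          cases h1
        · rw [hE] at h1
          by_cases he : e'.1 ∈ E₀
          · rw [edgeGraphMap_inner_of_mem _ he] at h1
            obtain ⟨rfl, rfl⟩ := Realization.inner.inj h1
            exact ⟨e', rfl, rfl⟩
          · rw [edgeGraphMap_inner_of_notMem _ he] at h1
            cases h1
      rw [h3, ← he']
      exact edgeGraphCoord_inner (hmono Finset.subset_union_left hj) e' t
    · have hv : ∀ E, ∃ K : (deleteFin G E).ConnectedComponent, x E = .vertex K := by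
        intro E
        rcases hE : x E with K | ⟨e, t⟩
        · exact ⟨K, rfl⟩
        · exact absurd ⟨E, e, t, hE⟩ hin
      choose K hK using hv
      have hanti : Antitone fun E => (K E).supp := by
        intro E E' h v hv
        have h1 := hx E E' h
        rw [hK, hK] at h1
        have h2 := Realization.vertex.inj h1
        have hv : (deleteFin G E').connectedComponentMk v = K E' := hv
        change v ∈ (K E).supp
        rw [← h2, ← hv]
        rfl
      obtain ⟨y, hy1, hy2⟩ := exists_direction_point hG hanti (fun E => (K E).nonempty_supp)
        edgeCoords hcover fun E A hA => supp_subset_or hA (K E)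
      refine ⟨y, fun E j hj => ?_⟩
      rw [hK]
      rcases j with A | ⟨e, s⟩
      · obtain ⟨v, hv⟩ := (K E).nonempty_supp
        exact (edgeGraphCoord_vertex hj hv).trans (hy2 E A hj v hv).symm
      · exact (edgeGraphCoord_inr_vertex _ _).trans (hy1 e s).symm

end

end EdgeEnds

/-! ### Assembly of the homeomorphisms. -/

theorem mainTheorem1 {V : Type*} [Infinite V] (G : SimpleGraph V) (hG : G.Connected) :
    -- the two families are inverse systems of multigraphs with finitely many vertices
    (EdgeEnds.IsInverseSystem (EdgeEnds.cutGraphMap G) ∧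
      ∀ M : Finset (EdgeEnds.FinCut G), Finite (EdgeEnds.Word G M)) ∧
    (EdgeEnds.IsInverseSystem (EdgeEnds.edgeGraphMap G) ∧
      ∀ E : Finset G.edgeSet, Finite (EdgeEnds.deleteFin G E).ConnectedComponent) ∧
    -- ITOP is Hausdorff
    T2Space (EdgeEnds.Itop G) ∧
    -- (i) and (ii) are the same quotient of `‖G‖ ∪ Ω'(G)`, with the same topology
    (∃ h : EdgeEnds.Itop G ≃ₜ EdgeEnds.Ifctop G,
      ∀ x : EdgeEnds.EndSpace G, h (EdgeEnds.Itop.mk x) = EdgeEnds.Ifctop.mk x) ∧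
    -- (ii) and (iii) are homeomorphic
    Nonempty (EdgeEnds.Ifctop G ≃ₜ EdgeEnds.inverseLimit (EdgeEnds.cutGraphMap G)) ∧
    -- (iii) and (iv) are homeomorphic
    Nonempty (EdgeEnds.inverseLimit (EdgeEnds.cutGraphMap G) ≃ₜ
      EdgeEnds.inverseLimit (EdgeEnds.edgeGraphMap G)) := by
  obtain ⟨hM, hMT2, Φ, hΦs, hΦi, hΦ⟩ := EdgeEnds.cutGraph_inverseSystem hG
  obtain ⟨hE, -, Ψ, hΨs, hΨi, hΨ⟩ := EdgeEnds.edgeGraph_inverseSystem hG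
  obtain ⟨f, hf⟩ := EdgeEnds.exists_homeomorph_quotient (EdgeEnds.etop G)
    (EdgeEnds.sameNhdsSetoid G) Φ hΦs (EdgeEnds.etop_eq_coordTopology.trans hΦi.symm)
    fun x y => (EdgeEnds.sameNhdsSetoid_iff_coord_eq x y).trans (hΦ x y).symm
  obtain ⟨f', hf'⟩ := EdgeEnds.exists_homeomorph_quotient (EdgeEnds.etop G)
    (EdgeEnds.sameNhdsSetoid G) Ψ hΨs (EdgeEnds.etop_eq_coordTopology.trans hΨi.symm)
    fun x y => (EdgeEnds.sameNhdsSetoid_iff_coord_eq x y).trans (hΨ x y).symm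
  -- Using the same map `Φ` for both quotients makes the composite homeomorphism send the class of
  -- each point to the class of that point.
  obtain ⟨g, hg⟩ := EdgeEnds.exists_homeomorph_quotient (EdgeEnds.fctop G)
    (EdgeEnds.cutSetoid G) Φ hΦs ((EdgeEnds.fctop_eq_coordTopology hG).trans hΦi.symm)
    fun x y => (EdgeEnds.cutSetoid_iff_coord_eq x y).trans (hΦ x y).symm
  let F : EdgeEnds.Itop G ≃ₜ EdgeEnds.inverseLimit (EdgeEnds.cutGraphMap G) := f
  let F' : EdgeEnds.Itop G ≃ₜ EdgeEnds.inverseLimit (EdgeEnds.edgeGraphMap G) := f'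
  let g' : EdgeEnds.Ifctop G ≃ₜ EdgeEnds.inverseLimit (EdgeEnds.cutGraphMap G) := g
  have hT2 : T2Space (EdgeEnds.Itop G) := F.symm.t2Space
  refine ⟨⟨hM, EdgeEnds.finite_word hG⟩, ⟨hE, EdgeEnds.finite_components hG⟩, hT2,
    ⟨F.trans g'.symm, fun x => ?_⟩, ⟨g'⟩, ⟨F.symm.trans F'⟩⟩
  exact g'.symm_apply_eq.2 ((hf x).trans (hg x).symm)
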